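/- For a lattice $\Lambda\subset\mathbb C$ put $g_2(\Lambda)=60\sum_{0\ne w\in\Lambda}w^{-4}$, $g_3(\Lambda)=140\sum_{0\ne w\in\Lambda}w^{-6}$ and $j(\Lambda)=2^6 3^3\,g_2(\Lambda)^3/\bigl(g_2(\Lambda)^3-27g_3(\Lambda)^2\bigr)$; then $j(\Lambda)$ depends on $\Lambda$ only up to scaling, and $j(\Lambda)=j(\omega_1/\omega_2)$ is the value of the modular function $j$ whenever $\omega_1,\omega_2$ is a basis of $\Lambda$ with $\operatorname{Im}(\omega_1/\omega_2)>0$. Let $\Sigma$ be an imaginary quadratic number field with an embedding into $\mathbb C$, and let $R$ be an order in $\Sigma$, i.e. a subring that is finitely generated as an additive group and spans $\Sigma$ over $\mathbb Q$. The ideal class group of $R$ is the group of invertible fractional ideals of $R$ modulo the principal ones. For an ideal class $\mathfrak k$ of $R$ let $j(\mathfrak k)$, the class invariant, be $j(\mathfrak a)$ for any ideal $\mathfrak a\in\mathfrak k$, viewed as a lattice in $\mathbb C$. Then: 1. $R$ has only finitely many ideal classes $\mathfrak k^{(1)},\dots,\mathfrak k^{(h)}$; 2. every class invariant $j(\mathfrak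 k^{(\nu)})$ is an algebraic integer; 3. the class polynomial $H_R(X)=\prod_{\nu=1}^{h}\bigl(X-j(\mathfrak k^{(\nu)})\bigr)$ has rational integer coefficients. -/

import Mathlib

open scoped nonZeroDivisors Polynomial

noncomputable section

/-! ### Lattice functions and the modular invariant `j` -/

/-- The lattice sum `∑ w⁻ⁿ` over the nonzero elements `w` of a lattice `Λ` in `ℂ`, for `n ≠ 0`
(the summand of `w = 0` is `(0 ^ n)⁻¹ = 0`). -/
def latticeG (Λ : Submodule ℤ ℂ) (n : ℕ) : ℂ := ∑' w : Λ, ((w : ℂ) ^ n)⁻¹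

/-- `g₂(Λ) = 60 ∑ w⁻⁴`. -/
def latticeG2 (Λ : Submodule ℤ ℂ) : ℂ := 60 * latticeG Λ 4

/-- `g₃(Λ) = 140 ∑ w⁻⁶`. -/
def latticeG3 (Λ : Submodule ℤ ℂ) : ℂ := 140 * latticeG Λ 6

/-- The discriminant `Δ(Λ) = g₂(Λ)³ - 27 g₃(Λ)²`. -/
def latticeDisc (Λ : Submodule ℤ ℂ) : ℂ := latticeG2 Λ ^ 3 - 27 * latticeG3 Λ ^ 2

/-- The invariant `j(Λ) = 2⁶ 3³ g₂(Λ)³ / Δ(Λ)` of a lattice `Λ` in `ℂ`. -/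
def latticeJ (Λ : Submodule ℤ ℂ) : ℂ := 2 ^ 6 * 3 ^ 3 * latticeG2 Λ ^ 3 / latticeDisc Λ

/-- The modular function `j(ω)`, the invariant of the lattice `ℤ ω + ℤ`. -/
def modularJ (ω : UpperHalfPlane) : ℂ := latticeJ (Submodule.span ℤ {(ω : ℂ), 1})

lemma latticeG_smul (Λ Λ' : Submodule ℤ ℂ) (z : ℂ) (hz : z ≠ 0)
    (h : ∀ w, w ∈ Λ' ↔ ∃ v ∈ Λ, w = z * v) (n : ℕ) :
    latticeG Λ' n = (z ^ n)⁻¹ * latticeG Λ n := by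
  let e : Λ ≃ Λ' :=
    { toFun := fun v => ⟨z * v, (h _).2 ⟨v, v.2, rfl⟩⟩
      invFun := fun w => ⟨z⁻¹ * w, by
        obtain ⟨v, hv, e⟩ := (h _).1 w.2
        rw [e, inv_mul_cancel_left₀ hz]; exact hv⟩
      left_inv := fun v => by ext; simp [hz]
      right_inv := fun w => by ext; simp [hz] }
  unfold latticeG
  rw [← e.tsum_eq, ← tsum_mul_left]
  refine tsum_congr fun v => ?_
  change ((z * (v : ℂ)) ^ n)⁻¹ = _
  rw [mul_pow, mul_inv]

/-- Homothetic lattices have the same invariant. -/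
lemma latticeJ_smul (Λ Λ' : Submodule ℤ ℂ) (z : ℂ) (hz : z ≠ 0)
    (h : ∀ w, w ∈ Λ' ↔ ∃ v ∈ Λ, w = z * v) : latticeJ Λ' = latticeJ Λ := by
  have h2 : latticeG2 Λ' = (z ^ 4)⁻¹ * latticeG2 Λ := by
    unfold latticeG2; rw [latticeG_smul Λ Λ' z hz h]; ring
  have h3 : latticeG3 Λ' = (z ^ 6)⁻¹ * latticeG3 Λ := by
    unfold latticeG3; rw [latticeG_smul Λ Λ' z hz h]; ring
  have hd : latticeDisc Λ' = (z ^ 12)⁻¹ * latticeDisc Λ := by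
    unfold latticeDisc; rw [h2, h3]; ring
  have hn : 2 ^ 6 * 3 ^ 3 * latticeG2 Λ' ^ 3
      = (z ^ 12)⁻¹ * (2 ^ 6 * 3 ^ 3 * latticeG2 Λ ^ 3) := by
    rw [h2]; ring
  unfold latticeJ
  rw [hn, hd, mul_div_mul_left _ _ (inv_ne_zero (pow_ne_zero _ hz))]

/-! ### Orders and their ideal classes -/

/-- A subring `R` of a number field `K` is an order of `K` if it is finitely generated as an
additive group and spans `K` over `ℚ`. -/
class IsNumberFieldOrder {K : Type*} [Field K] [NumberField K] (R : Subring K) : Prop where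
  finite : Module.Finite ℤ R
  span_eq_top : Submodule.span ℚ (R : Set K) = ⊤

section

variable {K : Type*} [Field K] {R : Subring K}

/-- The lattice in `ℂ` that a fractional ideal of `R` becomes under the embedding `φ`. -/
def idealLattice (φ : K →+* ℂ) (I : FractionalIdeal R⁰ K) : Submodule ℤ ℂ :=
  ((I : Submodule R K).restrictScalars ℤ).map (φ : K →+ ℂ).toIntLinearMap

lemma mem_idealLattice (φ : K →+* ℂ) (I : FractionalIdeal R⁰ K) (w : ℂ) :
    w ∈ idealLattice φ I ↔ ∃ a ∈ I, φ a = w := Iff.rfl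

end

section

variable {K : Type*} [Field K] [NumberField K] (R : Subring K) [IsNumberFieldOrder R]

/-- The field is the field of fractions of each of its orders. -/
instance IsNumberFieldOrder.isFractionRing : IsFractionRing R K := by
  have key : ∀ z : K, ∃ n : ℕ, n ≠ 0 ∧ (n : K) * z ∈ R := by
    intro z
    have hz : z ∈ Submodule.span ℚ (R : Set K) := by
      rw [IsNumberFieldOrder.span_eq_top]; trivial
    induction hz using Submodule.span_induction with
    | mem x hx => exact ⟨1, one_ne_zero, by simpa using hx⟩
    | zero => exact ⟨1, one_ne_zero, by simp [R.zero_mem]⟩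
    | add x y _ _ hx hy =>
      obtain ⟨m, hm, hmx⟩ := hx
      obtain ⟨n, hn, hny⟩ := hy
      refine ⟨m * n, mul_ne_zero hm hn, ?_⟩
      have : ((m * n : ℕ) : K) * (x + y) = (n : K) * ((m : K) * x) + (m : K) * ((n : K) * y) := by
        push_cast; ring
      rw [this]
      exact R.add_mem (R.mul_mem (natCast_mem R n) hmx) (R.mul_mem (natCast_mem R m) hny)
    | smul q x _ hx =>
      obtain ⟨m, hm, hmx⟩ := hx
      refine ⟨q.den * m, mul_ne_zero q.den_nz hm, ?_⟩
      have hq : (q.den : K) * (q : K) = (q.num : K) := by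
        have := Rat.den_mul_eq_num q
        exact_mod_cast congrArg (Rat.cast : ℚ → K) this
      have : ((q.den * m : ℕ) : K) * (q • x) = (q.num : K) * ((m : K) * x) := by
        rw [Rat.smul_def, ← hq]; push_cast; ring
      rw [this]
      exact R.mul_mem (intCast_mem R _) hmx
  refine IsFractionRing.of_field R K fun z => ?_
  obtain ⟨n, hn, hnz⟩ := key z
  refine ⟨⟨_, hnz⟩, ⟨n, natCast_mem R n⟩, ?_⟩
  have hn' : (n : K) ≠ 0 := Nat.cast_ne_zero.2 hn
  change _ = (n : K) * z / (n : K)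
  field_simp

variable {R}

lemma latticeJ_idealLattice_mul (φ : K →+* ℂ) (I : FractionalIdeal R⁰ K) (x : Kˣ) :
    latticeJ (idealLattice φ (I * FractionalIdeal.spanSingleton R⁰ (x : K)))
      = latticeJ (idealLattice φ I) := by
  refine latticeJ_smul _ _ (φ x) (by simp) fun w => ?_
  rw [mul_comm, mem_idealLattice]
  constructor
  · rintro ⟨a, ha, rfl⟩
    obtain ⟨b, hb, rfl⟩ := FractionalIdeal.mem_singleton_mul.1 ha
    exact ⟨φ b, ⟨b, hb, rfl⟩, map_mul _ _ _⟩
  · rintro ⟨_, ⟨b, hb, rfl⟩, rfl⟩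
    exact ⟨x * b, FractionalIdeal.mem_singleton_mul.2 ⟨b, hb, rfl⟩, map_mul _ _ _⟩

/-- The class invariant `j(𝔨)` of a class `𝔨` of invertible fractional ideals of the order `R`
modulo principal ones: the invariant of the lattice of any ideal in `𝔨`. -/
def classInvariant (φ : K →+* ℂ) (c : ClassGroup R) : ℂ :=
  Quotient.lift (s := QuotientGroup.leftRel (toPrincipalIdeal R K).range)
    (fun I : (FractionalIdeal R⁰ K)ˣ => latticeJ (idealLattice φ (I : FractionalIdeal R⁰ K)))
    (by
      intro I J h
      obtain ⟨x, hx⟩ := QuotientGroup.leftRel_apply.1 h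
      have hJ : J = I * toPrincipalIdeal R K x := by rw [hx]; group
      change latticeJ _ = latticeJ _
      rw [hJ, Units.val_mul, coe_toPrincipalIdeal, latticeJ_idealLattice_mul])
    (ClassGroup.equiv K c)

/-- The class invariant computed from an ideal in the class. -/
lemma classInvariant_mk (φ : K →+* ℂ) (I : (FractionalIdeal R⁰ K)ˣ) :
    classInvariant φ (ClassGroup.mk K I)
      = latticeJ (idealLattice φ (I : FractionalIdeal R⁰ K)) := by
  unfold classInvariant
  rw [ClassGroup.equiv_mk]
  simp

/-- If `α₁, α₂` is a basis of an ideal in the class and `ω = α₁ / α₂` lies in the upper half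
plane, the class invariant is `j(ω)`. -/
lemma classInvariant_mk_of_basis (φ : K →+* ℂ) (I : (FractionalIdeal R⁰ K)ˣ) (α₁ α₂ : K)
    (hI : ((I : FractionalIdeal R⁰ K) : Submodule R K).restrictScalars ℤ
      = Submodule.span ℤ {α₁, α₂})
    (ω : UpperHalfPlane) (hω : (ω : ℂ) = φ α₁ / φ α₂) :
    classInvariant φ (ClassGroup.mk K I) = modularJ ω := by
  have h2 : φ α₂ ≠ 0 := fun h => ω.ne_zero (by rw [hω, h, div_zero])
  have h1 : φ α₁ = φ α₂ * ω := by rw [hω]; field_simp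
  rw [classInvariant_mk]
  refine latticeJ_smul _ _ (φ α₂) h2 fun w => ?_
  unfold idealLattice
  rw [hI, Submodule.map_span, Set.image_pair]
  simp only [Submodule.mem_span_pair, AddMonoidHom.coe_toIntLinearMap, AddMonoidHom.coe_coe,
    zsmul_eq_mul]
  constructor
  · rintro ⟨a, b, rfl⟩
    exact ⟨_, ⟨a, b, rfl⟩, by rw [h1]; ring⟩
  · rintro ⟨_, ⟨a, b, rfl⟩, rfl⟩
    exact ⟨a, b, by rw [h1]; ring⟩

variable (R)

/-- The class polynomial `H_R(X) = ∏ (X - j(𝔨))`, the product over all ideal classes `𝔨` of `R`.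
(The finite product is meaningful because the class group of `R` is finite.) -/
def classPolynomial (φ : K →+* ℂ) : ℂ[X] :=
  ∏ᶠ c : ClassGroup R, (Polynomial.X - Polynomial.C (classInvariant φ c))

end

end

/-! Compare a lattice Λ = ℤτ + ℤ with its sublattices Λ' of index m, leaving out those of the form
sΛ, for which j(Λ) - j(Λ') is identically zero. The product of the differences j(Λ) - j(Λ')
(`heckeProduct`) is invariant under SL(2, ℤ), because a change of basis permutes the sublattices,
and it has at most a pole at i∞. Hence it is F_m(j(Λ)) for a polynomial F_m (`modularPoly`,
`eq_eval_jPoly`).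

The expansion of q j has integral coefficients, so the factors have expansions in exp(2πiτ/m) whose
coefficients involve only integers and roots of unity. This has two consequences. An endomorphism σ
of ℂ permutes the factors, so it fixes F_m (`modularPoly_map`). If m is not a square, each factor
has a unit as its lowest coefficient; the leading coefficient of F_m is then a unit among the
algebraic integers, and all roots of F_m are algebraic integers
(`modularPoly_ne_zero_and_isIntegral`).

On the other hand, j determines Λ up to homothety (`exists_homothety_of_modularJ_eq`, by way of the
differential equation of ℘). So F_m(j(Λ)) = 0 means that xΛ is one of the sublattices Λ' for some x,
i.e. that Λ has a multiplier x of norm m which is not an integer times a multiplier of norm 1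
(`modularPoly_isRoot_iff`).

The classes of R correspond injectively to the lattices with multiplier ring R up to homothety, and
every such lattice occurs (`classInvariant_injective`, `exists_classInvariant_eq`). Since R has a
suitable element of nonsquare norm m, all class invariants are roots of this one F_m: there are
finitely many, and they are integral. The set of all m with F_m(j(Λ)) = 0 does not change when σ is
applied to j(Λ), and it determines an imaginary quadratic order (`eq_of_normSet_quadOrder_eq`). As j
is surjective, σ(j(𝔨)) is the invariant of some lattice, which then has multiplier ring R; so σ
permutes the class invariants. The coefficients of H_R are thus algebraic integers fixed by every
endomorphism of ℂ, hence rational integers. -/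

noncomputable section

open UpperHalfPlane Complex Function ModularForm
open scoped MatrixGroups Manifold Topology

/-! ### Expansions in powers of `exp (2πiτ/h)` -/

/-- `f` is the sum of the power series `P` in `exp (2πiτ/h)` on the upper half plane. -/
def HasQExp (h : ℕ) (P : PowerSeries ℂ) (f : ℍ → ℂ) : Prop :=
  ∀ τ : ℍ, HasSum (fun n => P.coeff n * Periodic.qParam h τ ^ n) (f τ)

namespace HasQExp

variable {h : ℕ} {P Q : PowerSeries ℂ} {f g : ℍ → ℂ}

lemma sub (hf : HasQExp h P f) (hg : HasQExp h Q g) : HasQExp h (P - Q) (f - g) := fun τ => by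
  simpa [sub_mul] using (hf τ).sub (hg τ)

lemma const (h : ℕ) (c : ℂ) : HasQExp h (PowerSeries.C c) (fun _ => c) := fun τ => by
  convert hasSum_ite_eq 0 c using 2 with n
  rcases eq_or_ne n 0 with rfl | hn
  · simp
  · simp [PowerSeries.coeff_C, hn]

lemma mul (hf : HasQExp h P f) (hg : HasQExp h Q g) : HasQExp h (P * Q) (f * g) := fun τ => by
  have h1 := (hf τ).summable.norm
  have h2 := (hg τ).summable.norm
  have key := (summable_norm_sum_mul_antidiagonal_of_summable_norm h1 h2).of_norm.hasSum
  rw [← tsum_mul_tsum_eq_tsum_sum_antidiagonal_of_summable_norm h1 h2,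
    (hf τ).tsum_eq, (hg τ).tsum_eq] at key
  convert! key using 2 with n
  rw [PowerSeries.coeff_mul, Finset.sum_mul]
  refine Finset.sum_congr rfl fun x hx => ?_
  rw [← Finset.HasAntidiagonal.mem_antidiagonal.1 hx, pow_add]
  ring

lemma smul (c : ℂ) (hf : HasQExp h P f) : HasQExp h (PowerSeries.C c * P) (fun τ => c * f τ) :=
  (const h c).mul hf

lemma pow (hf : HasQExp h P f) (n : ℕ) : HasQExp h (P ^ n) (f ^ n) := by
  induction n with
  | zero => simpa using! const h 1
  | succ n ih => simpa [pow_succ] using ih.mul hf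

lemma prod {ι : Type*} (s : Finset ι) {P : ι → PowerSeries ℂ} {f : ι → ℍ → ℂ}
    (hf : ∀ i ∈ s, HasQExp h (P i) (f i)) : HasQExp h (∏ i ∈ s, P i) (∏ i ∈ s, f i) := by
  classical
  induction s using Finset.induction_on with
  | empty => simpa using! const h 1
  | insert a s ha ih =>
    rw [Finset.prod_insert ha, Finset.prod_insert ha]
    exact (hf a (by simp)).mul (ih fun i hi => hf i (by simp [hi]))

lemma X_pow (h k : ℕ) : HasQExp h (PowerSeries.X ^ k) (fun τ => Periodic.qParam h τ ^ k) := by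
  intro τ
  convert hasSum_ite_eq k (Periodic.qParam h τ ^ k) using 2 with n
  rw [PowerSeries.coeff_X_pow]
  split_ifs with hn
  · simp [hn]
  · simp

/-- Every q with 0 < |q| < 1 is exp(2πiτ/h) for some τ in ℍ, so convergence on ℍ forces radius of
convergence at least 1. The analytic F extends over q = 0; uniqueness, holomorphy and the limit at
i∞ are read off from it. -/
lemma exists_hasFPowerSeriesOnBall (hh : 0 < h) (hf : HasQExp h P f) :
    ∃ F : ℂ → ℂ, HasFPowerSeriesOnBall F (.ofScalars ℂ fun n => P.coeff n) 0 1 ∧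
      ∀ τ : ℍ, f τ = F (Periodic.qParam h τ) := by
  have hh' : (0 : ℝ) < h := by exact_mod_cast hh
  set p : FormalMultilinearSeries ℂ ℂ ℂ := .ofScalars ℂ fun n => P.coeff n
  have hrad : 1 ≤ p.radius := by
    refine le_of_forall_lt_imp_le_of_dense fun r hr => ?_
    rcases eq_or_ne r 0 with rfl | hr'
    · simp
    lift r to NNReal using hr.ne_top
    have hr1 : ‖((r : ℝ) : ℂ)‖ < 1 := by simpa using hr
    have hr0 : ((r : ℝ) : ℂ) ≠ 0 := by simpa using hr'
    have him := Periodic.im_invQParam_pos_of_norm_lt_one hh' hr1 hr0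
    have hs := (hf ⟨_, him⟩).summable.norm
    apply FormalMultilinearSeries.le_radius_of_summable
    simpa [p, Periodic.qParam_right_inv hh'.ne' hr0] using hs
  have hp := (p.hasFPowerSeriesOnBall (lt_of_lt_of_le one_pos hrad)).mono one_pos hrad
  refine ⟨p.sum, hp, fun τ => ?_⟩
  have hq : ‖Periodic.qParam h τ‖ < 1 := Periodic.norm_qParam_lt_one hh' τ.im_pos
  have := hp.hasSum (y := Periodic.qParam h τ) (by simpa [Metric.mem_eball, edist_zero_right, enorm_eq_nnnorm] using! hq)
  rw [zero_add] at this
  refine (hf τ).unique ?_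
  convert! this using 2 with n
  simp [p, mul_comm]

lemma unique (hh : 0 < h) (hP : HasQExp h P f) (hQ : HasQExp h Q f) : P = Q := by
  have hh' : (0 : ℝ) < h := by exact_mod_cast hh
  obtain ⟨F, hF, hFf⟩ := (hP.sub hQ).exists_hasFPowerSeriesOnBall hh
  have hz : ∀ᶠ q in 𝓝[≠] (0 : ℂ), F q = 0 := by
    filter_upwards [self_mem_nhdsWithin, nhdsWithin_le_nhds (Metric.ball_mem_nhds 0 one_pos)]
      with q hq0 hq1
    have him := Periodic.im_invQParam_pos_of_norm_lt_one hh' (by simpa using hq1) hq0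
    have := hFf ⟨_, him⟩
    rw [UpperHalfPlane.coe_mk, Periodic.qParam_right_inv hh'.ne' hq0] at this
    rw [← this]; simp
  have hz' : F =ᶠ[𝓝 0] 0 := by
    exact (hF.hasFPowerSeriesAt.continuousAt.eventuallyEq_nhds_iff_eventuallyEq_nhdsNE
      (continuousAt_const (y := (0 : ℂ)))).1 hz
  have h0 := (hF.hasFPowerSeriesAt.congr hz').eq_zero
  rw [← sub_eq_zero]
  ext n
  have := congrArg (fun p : FormalMultilinearSeries ℂ ℂ ℂ => p.coeff n) h0
  simp only [FormalMultilinearSeries.coeff_ofScalars] at this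
  rw [this]
  rfl

lemma mdifferentiable (hh : 0 < h) (hf : HasQExp h P f) : MDiff f := by
  have hh' : (0 : ℝ) < h := by exact_mod_cast hh
  obtain ⟨F, hF, hFf⟩ := hf.exists_hasFPowerSeriesOnBall hh
  rw [UpperHalfPlane.mdifferentiable_iff]
  have h1 : DifferentiableOn ℂ (fun z => F (Periodic.qParam h z)) {z : ℂ | 0 < z.im} := by
    refine hF.differentiableOn.comp Periodic.differentiable_qParam.differentiableOn fun z hz => ?_
    have hq : ‖Periodic.qParam h z‖ < 1 := Periodic.norm_qParam_lt_one hh' hz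
    simpa [Metric.mem_eball, edist_zero_right, enorm_eq_nnnorm] using! hq
  refine h1.congr fun z hz => ?_
  simp [hFf, UpperHalfPlane.ofComplex_apply_of_im_pos hz]

lemma isBoundedAtImInfty (hh : 0 < h) (hf : HasQExp h P f) : IsBoundedAtImInfty f :=
  UpperHalfPlane.isBoundedAtImInfty_of_hasSum_qExpansion (h := h) (by exact_mod_cast hh) hf

end HasQExp

/-- A holomorphic function on the upper half plane that is bounded at `i∞` and invariant under
`SL(2, ℤ)` is constant. -/
lemma eq_const_of_invariant {f : ℍ → ℂ} (hf : MDiff f) (hb : IsBoundedAtImInfty f)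
    (hinv : ∀ (γ : SL(2, ℤ)) (τ : ℍ), f (γ • τ) = f τ) : ∃ c, ∀ τ, f τ = c := by
  have hs : ∀ γ : SL(2, ℤ), f ∣[(0 : ℤ)] γ = f := fun γ => by
    ext τ
    rw [SL_slash_apply, hinv]
    simp
  let F : ModularForm 𝒮ℒ 0 :=
    { toFun := f
      slash_action_eq' := fun _ ⟨γ, hγ⟩ => hγ ▸ hs γ
      holo' := hf
      -- Every cusp is an SL(2, ℤ)-translate of i∞, and f equals all its slashes, so the bound at i∞
      -- suffices.
      bdd_at_cusps' := fun {c} hc => by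
        rw [Subgroup.IsArithmetic.isCusp_iff_isCusp_SL2Z] at hc
        rw [OnePoint.isBoundedAt_iff_forall_SL2Z hc]
        intro γ _
        rw [hs γ]
        exact hb }
  obtain ⟨c, hc⟩ := ModularFormClass.levelOne_weight_zero_const F
  exact ⟨c, fun τ => congrFun hc τ⟩

/-- An invariant function with a `q`-expansion without constant term vanishes. -/
lemma HasQExp.eq_zero_of_invariant {f : ℍ → ℂ} {P : PowerSeries ℂ} (hf : HasQExp 1 P f)
    (h0 : P.coeff 0 = 0) (hinv : ∀ (γ : SL(2, ℤ)) (τ : ℍ), f (γ • τ) = f τ) (τ : ℍ) :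
    f τ = 0 := by
  obtain ⟨c, hc⟩ := eq_const_of_invariant (hf.mdifferentiable one_pos)
    (hf.isBoundedAtImInfty one_pos) hinv
  have := hf.unique one_pos (funext hc ▸ HasQExp.const 1 c)
  rw [hc, ← h0, this]
  simp

/-! ### The modular function `j` -/

/-- The lattice `ℤ τ + ℤ`. -/
def upperLattice (τ : ℍ) : Submodule ℤ ℂ := Submodule.span ℤ {(τ : ℂ), 1}

lemma mem_upperLattice {τ : ℍ} {w : ℂ} :
    w ∈ upperLattice τ ↔ ∃ m n : ℤ, w = m * τ + n := by
  simp [upperLattice, Submodule.mem_span_pair, eq_comm]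

lemma linearIndependent_pair_of_im_ne_zero {z : ℂ} (hz : z.im ≠ 0) :
    LinearIndependent ℝ ![z, 1] := by
  refine LinearIndependent.pair_iff.2 fun s t h => ?_
  have h1 := congrArg Complex.im h
  have h2 := congrArg Complex.re h
  simp at h1 h2
  obtain rfl : s = 0 := by tauto
  simpa using h2

/-- The pair of periods `τ, 1`. -/
def upperPeriodPair (τ : ℍ) : PeriodPair where
  ω₁ := τ
  ω₂ := 1
  indep := linearIndependent_pair_of_im_ne_zero τ.im_ne_zero

lemma latticeG_upperLattice (τ : ℍ) (k : ℕ) :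
    latticeG (upperLattice τ) k = ∑' v : Fin 2 → ℤ, EisensteinSeries.eisSummand k v τ := by
  let e := (finTwoArrowEquiv ℤ).trans (upperPeriodPair τ).latticeEquivProd.symm.toEquiv
  change ∑' w : (upperPeriodPair τ).lattice, ((w : ℂ) ^ k)⁻¹ = _
  rw [← e.tsum_eq]
  refine tsum_congr fun v => ?_
  have : ((e v : (upperPeriodPair τ).lattice) : ℂ) = v 0 * τ + v 1 := by
    exact (PeriodPair.latticeEquiv_symm_apply _ (v 0, v 1)).trans (by simp [upperPeriodPair])
  rw [this, EisensteinSeries.eisSummand]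
  simp

lemma latticeG_upperLattice_eq (τ : ℍ) {k : ℕ} (hk : 3 ≤ k) :
    latticeG (upperLattice τ) k = 2 * riemannZeta k * E hk τ := by
  rw [latticeG_upperLattice, tsum_eisSummand_eq_riemannZeta_mul_eisensteinSeries hk,
    show E hk τ = (1 / 2 : ℂ) • EisensteinSeries.eisensteinSeriesSIF (N := 1) 0 k τ from rfl,
    EisensteinSeries.eisensteinSeriesSIF_apply, smul_eq_mul]
  ring

lemma riemannZeta_six : riemannZeta 6 = Real.pi ^ 6 / 945 := by
  have := riemannZeta_two_mul_nat (k := 3) (by norm_num)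
  norm_num [show bernoulli 6 = 1 / 42 by decide +kernel, Nat.factorial] at this
  rw [this]; ring

lemma latticeG2_upperLattice (τ : ℍ) :
    latticeG2 (upperLattice τ) = 4 / 3 * Real.pi ^ 4 * E₄ τ := by
  have := latticeG_upperLattice_eq τ (k := 4) (by norm_num)
  rw [latticeG2, this]
  push_cast
  rw [riemannZeta_four]
  ring

lemma latticeG3_upperLattice (τ : ℍ) :
    latticeG3 (upperLattice τ) = 8 / 27 * Real.pi ^ 6 * E₆ τ := by
  have := latticeG_upperLattice_eq τ (k := 6) (by norm_num)
  rw [latticeG3, this]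
  push_cast
  rw [riemannZeta_six]
  ring

lemma latticeDisc_upperLattice (τ : ℍ) :
    latticeDisc (upperLattice τ) = 4096 * Real.pi ^ 12 * discriminant τ := by
  rw [latticeDisc, latticeG2_upperLattice, latticeG3_upperLattice,
    discriminant_eq_E₄_cube_sub_E₆_sq]
  ring

lemma latticeDisc_upperLattice_ne_zero (τ : ℍ) : latticeDisc (upperLattice τ) ≠ 0 := by
  rw [latticeDisc_upperLattice]
  exact mul_ne_zero (mul_ne_zero (by norm_num) (pow_ne_zero _ (by simp))) (discriminant_ne_zero τ)

/-- The constants cancel because 2⁶ 3³ (4/3)³ = 4096. -/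
lemma modularJ_eq (τ : ℍ) : modularJ τ = E₄ τ ^ 3 / discriminant τ := by
  change latticeJ (upperLattice τ) = _
  rw [latticeJ, latticeG2_upperLattice, latticeDisc_upperLattice]
  have := discriminant_ne_zero τ
  have := Complex.ofReal_ne_zero.2 Real.pi_ne_zero
  field_simp
  ring

lemma modularJ_smul (γ : SL(2, ℤ)) (τ : ℍ) : modularJ (γ • τ) = modularJ τ := by
  have h4 := SlashInvariantForm.slash_action_eqn' (Γ := 𝒮ℒ) (k := 4) E₄ (γ := Matrix.SpecialLinearGroup.mapGL ℝ γ)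
    ⟨γ, rfl⟩ τ
  have hd := SlashInvariantForm.slash_action_eqn' (Γ := 𝒮ℒ) (k := 12) CuspForm.discriminant
    (γ := Matrix.SpecialLinearGroup.mapGL ℝ γ) ⟨γ, rfl⟩ τ
  have hne := discriminant_ne_zero (γ • τ)
  rw [modularJ_eq, modularJ_eq]
  change E₄ (γ • τ) = _ at h4
  change discriminant (γ • τ) = _ * discriminant τ at hd
  rw [hd] at hne
  rw [h4, hd, mul_pow]
  set w := (((Matrix.SpecialLinearGroup.mapGL ℝ) γ : GL (Fin 2) ℝ) 1 0 : ℂ) * (τ : ℂ)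
    + (((Matrix.SpecialLinearGroup.mapGL ℝ) γ : GL (Fin 2) ℝ) 1 1 : ℂ)
  have hw : (w ^ (4 : ℤ)) ^ 3 = w ^ (12 : ℤ) := by norm_cast; ring
  rw [hw, mul_div_mul_left _ _ (left_ne_zero_of_mul hne)]

/-! ### Integral q-expansions of E₄, E₆, Δ and j -/

open ArithmeticFunction in
/-- The series `∑ σ_k(n) Xⁿ`. -/
def sigmaSeries (k : ℕ) : PowerSeries ℤ := PowerSeries.mk fun n => (sigma k n : ℤ)

/-- The `q`-expansion of `E₄`. -/
def e4Series : PowerSeries ℤ := 1 + (240 : ℤ) • sigmaSeries 3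

/-- The `q`-expansion of `E₆`. -/
def e6Series : PowerSeries ℤ := 1 - (504 : ℤ) • sigmaSeries 5

lemma hasQExp_qExpansion {k : ℤ} (f : ModularForm 𝒮ℒ k) : HasQExp 1 (qExpansion 1 f) f := fun τ => by
  simpa using ModularForm.hasSum_qExpansion f one_pos one_mem_strictPeriods_SL τ

lemma hasQExp_E₄ : HasQExp 1 (e4Series.map (Int.castRingHom ℂ)) E₄ := by
  have : e4Series.map (Int.castRingHom ℂ) = qExpansion 1 E₄ := by
    ext n
    rw [EisensteinSeries.E_qExpansion_coeff _ ⟨2, rfl⟩, show bernoulli 4 = -1 / 30 by decide +kernel]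
    rcases eq_or_ne n 0 with rfl | hn
    · rw [PowerSeries.coeff_map]
      simp [e4Series, sigmaSeries, -zsmul_eq_mul]
    · rw [PowerSeries.coeff_map]
      simp [e4Series, sigmaSeries, PowerSeries.coeff_one, hn, -zsmul_eq_mul]
      norm_num
  exact this ▸ hasQExp_qExpansion E₄

lemma hasQExp_E₆ : HasQExp 1 (e6Series.map (Int.castRingHom ℂ)) E₆ := by
  have : e6Series.map (Int.castRingHom ℂ) = qExpansion 1 E₆ := by
    ext n
    rw [EisensteinSeries.E_qExpansion_coeff _ ⟨3, rfl⟩, show bernoulli 6 = 1 / 42 by decide +kernel]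
    rcases eq_or_ne n 0 with rfl | hn
    · rw [PowerSeries.coeff_map]
      simp [e6Series, sigmaSeries, -zsmul_eq_mul]
    · rw [PowerSeries.coeff_map]
      simp [e6Series, sigmaSeries, PowerSeries.coeff_one, hn, -zsmul_eq_mul]
      norm_num
  exact this ▸ hasQExp_qExpansion E₆

/-- The congruence 5d³ + 7d⁵ ≡ 0 mod 12 holds for each divisor d separately. It is what makes (E₄³ -
E₆²)/1728 integral. -/
lemma twelve_dvd_sigma (n : ℕ) : (12 : ℤ) ∣
    5 * (ArithmeticFunction.sigma 3 n : ℤ) + 7 * (ArithmeticFunction.sigma 5 n : ℤ) := by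
  rw [ArithmeticFunction.sigma_apply, ArithmeticFunction.sigma_apply]
  push_cast
  rw [Finset.mul_sum, Finset.mul_sum, ← Finset.sum_add_distrib]
  refine Finset.dvd_sum fun d _ => ?_
  have h : ∀ x : ZMod 12, 5 * x ^ 3 + 7 * x ^ 5 = 0 := by decide
  have := h (d : ZMod 12)
  refine (ZMod.intCast_zmod_eq_zero_iff_dvd _ 12).1 ?_
  push_cast
  exact this

lemma exists_discSeries : ∃ D : PowerSeries ℤ, D.coeff 0 = 1 ∧
    (1728 : ℤ) • (PowerSeries.X * D) = e4Series ^ 3 - e6Series ^ 2 := by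
  choose w hw using twelve_dvd_sigma
  set A := sigmaSeries 3 with hA
  set B := sigmaSeries 5 with hB
  let W : PowerSeries ℤ := PowerSeries.mk w
  -- With E₄ = 1 + 240A and E₆ = 1 - 504B one has E₄³ - E₆² = 144(5A + 7B) + 3·240²A² + 240³A³ -
  -- 504²B²; division by 1728 gives W = (5A + 7B)/12 and the constants 100, 8000 and 147.
  let D : PowerSeries ℤ := W + (100 : ℤ) • A ^ 2 + (8000 : ℤ) • A ^ 3
    - (147 : ℤ) • B ^ 2
  have hW : (12 : ℤ) • W = (5 : ℤ) • A + (7 : ℤ) • B := by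
    ext n
    simp [W, hA, hB, sigmaSeries, hw, -zsmul_eq_mul]
  have hA0 : A.coeff 0 = 0 := by simp [hA, sigmaSeries]
  have hB0 : B.coeff 0 = 0 := by simp [hB, sigmaSeries]
  have hw0 : w 0 = 0 := by have := hw 0; simp at this; omega
  have hw1 : w 1 = 1 := by have := hw 1; simp at this; omega
  have hD0 : D.coeff 0 = 0 := by
    rw [PowerSeries.coeff_zero_eq_constantCoeff_apply] at *
    simp [D, W, hA0, hB0, hw0]
  have hX2 : ∀ F : PowerSeries ℤ, F.coeff 0 = 0 → ∀ k, (F ^ (k + 2)).coeff 1 = 0 := by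
    intro F hF k
    obtain ⟨G, rfl⟩ := PowerSeries.X_dvd_iff.2 (by simpa using hF)
    rw [mul_pow, PowerSeries.coeff_X_pow_mul', if_neg (by omega)]
  have hD1 : D.coeff 1 = 1 := by
    have e1 := hX2 A hA0 0
    have e2 := hX2 A hA0 1
    have e3 := hX2 B hB0 0
    norm_num at e1 e2 e3
    simp [D, W, hw1, e1, e2, e3, -zsmul_eq_mul]
  obtain ⟨D', hD'⟩ := PowerSeries.X_dvd_iff.2 (by simpa using hD0)
  refine ⟨D', ?_, ?_⟩
  · rw [hD', PowerSeries.coeff_succ_X_mul 0] at hD1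
    exact hD1
  · rw [← hD']
    simp only [D, e4Series, e6Series, ← hA, ← hB]
    simp only [zsmul_eq_mul] at hW ⊢
    push_cast at hW ⊢
    linear_combination 144 * hW

/-- The power series `D` with integral coefficients such that `Δ = q D(q)`. -/
def discSeries : PowerSeries ℤ := exists_discSeries.choose

/-- The power series with integral coefficients whose sum is `q j`. -/
def jSeries : PowerSeries ℤ := e4Series ^ 3 * PowerSeries.invOfUnit discSeries 1

lemma constantCoeff_discSeries : discSeries.constantCoeff = 1 := by
  rw [← PowerSeries.coeff_zero_eq_constantCoeff_apply]
  exact exists_discSeries.choose_spec.1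

lemma jSeries_mul_discSeries : jSeries * discSeries = e4Series ^ 3 := by
  rw [jSeries, mul_assoc, mul_comm (PowerSeries.invOfUnit _ _),
    PowerSeries.mul_invOfUnit _ _ (by simp [constantCoeff_discSeries]), mul_one]

lemma jSeries_coeff_zero : jSeries.coeff 0 = 1 := by
  simp [jSeries, e4Series, sigmaSeries]

lemma hasQExp_discriminant : HasQExp 1
    (PowerSeries.X * discSeries.map (Int.castRingHom ℂ)) discriminant := by
  have h := ((hasQExp_E₄.pow 3).sub (hasQExp_E₆.pow 2)).smul (1728⁻¹)
  have e := congrArg (PowerSeries.map (Int.castRingHom ℂ)) exists_discSeries.choose_spec.2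
  simp only [map_sub, map_pow, map_mul, map_zsmul, PowerSeries.map_X] at e
  rw [← e] at h
  convert h using 1
  · rw [zsmul_eq_mul, ← mul_assoc, show ((1728 : ℤ) : PowerSeries ℂ) = PowerSeries.C ((1728 : ℤ) : ℂ) by rw [map_intCast],
      ← map_mul]
    norm_num [discSeries]
  · ext τ
    rw [discriminant_eq_E₄_cube_sub_E₆_sq]
    simp [div_eq_inv_mul]

/-- Written as E₄³ · (q/Δ), the function q j is holomorphic, periodic and bounded at i∞ (since q =
O(Δ)), so it has some q-expansion. Multiplying by Δ and comparing with q E₄³ identifies that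
expansion, as `discSeries` can be cancelled. -/
lemma hasQExp_modularJ : HasQExp 1 (jSeries.map (Int.castRingHom ℂ))
    (fun τ => Periodic.qParam 1 τ * modularJ τ) := by
  set f : ℍ → ℂ := fun τ => Periodic.qParam 1 τ * modularJ τ with hf
  have hq : MDiff (fun τ : ℍ => Periodic.qParam 1 τ) := by
    simpa using (HasQExp.X_pow 1 1).mdifferentiable one_pos
  have hfeq : f = fun τ => E₄ τ ^ 3 * (Periodic.qParam 1 τ / discriminant τ) := by
    ext τ
    rw [hf]
    simp only [modularJ_eq]
    ring
  have hmd : MDiff f := by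
    rw [hfeq]
    exact (E₄.holo'.pow 3).mul (hq.div CuspForm.discriminant.holo' discriminant_ne_zero)
  have hbd : IsBoundedAtImInfty f := by
    rw [hfeq]
    have h1 : IsBoundedAtImInfty ((E₄ : ℍ → ℂ) ^ 3) := ((hasQExp_E₄.pow 3).isBoundedAtImInfty one_pos)
    have h2 : IsBoundedAtImInfty (fun τ : ℍ => Periodic.qParam 1 τ / discriminant τ) := by
      have : (fun τ : ℍ => Periodic.qParam 1 τ) =O[atImInfty] discriminant := by
        refine (Asymptotics.isBigO_of_le _ fun τ => ?_).trans exp_isBigO_discriminant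
        simp [Periodic.norm_qParam]
      exact (Asymptotics.div_isBoundedUnder_of_isBigO this).isBigO_one ℝ
    exact h1.mul h2
  have hper : Periodic (f ∘ ofComplex) (1 : ℝ) := by
    have h1 := SlashInvariantFormClass.periodic_comp_ofComplex E₄ one_mem_strictPeriods_SL
    have h2 := SlashInvariantFormClass.periodic_comp_ofComplex CuspForm.discriminant
      one_mem_strictPeriods_SL
    have h3 : Periodic ((fun τ : ℍ => Periodic.qParam 1 τ) ∘ ofComplex) (1 : ℝ) := fun w => by
      by_cases hw : 0 < w.im
      · have hw' : 0 < (w + (1 : ℝ)).im := by simpa using hw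
        rw [comp_apply, comp_apply, ofComplex_apply_of_im_pos hw, ofComplex_apply_of_im_pos hw']
        simp [Periodic.qParam, mul_add, Complex.exp_add]
      · have hw' : (w + (1 : ℝ)).im ≤ 0 := by simpa using hw
        rw [comp_apply, comp_apply, ofComplex_apply_of_im_nonpos (not_lt.1 hw),
          ofComplex_apply_of_im_nonpos hw']
    intro w
    have e1 := h1 w
    have e2 := h2 w
    have e3 := h3 w
    simp only [comp_apply, hfeq, CuspForm.coe_discriminant] at e1 e2 e3 ⊢
    rw [e1, e2, e3]
  have hP : HasQExp 1 (qExpansion 1 f) f := fun τ => by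
    simpa using UpperHalfPlane.hasSum_qExpansion one_pos hper hmd hbd τ
  have key : qExpansion 1 f * discSeries.map (Int.castRingHom ℂ)
      = (e4Series ^ 3).map (Int.castRingHom ℂ) := by
    have h1 := hP.mul hasQExp_discriminant
    have h2 := (HasQExp.X_pow 1 1).mul (hasQExp_E₄.pow 3)
    have : f * discriminant = (fun τ : ℍ => Periodic.qParam (1 : ℕ) τ ^ 1) * (E₄ : ℍ → ℂ) ^ 3 := by
      ext τ
      simp only [hfeq, Pi.mul_apply, Pi.pow_apply]
      field_simp [discriminant_ne_zero τ]
      simp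
    rw [this] at h1
    have h3 := h1.unique one_pos h2
    rw [pow_one, mul_left_comm] at h3
    rw [map_pow]
    exact mul_left_cancel₀ PowerSeries.X_ne_zero h3
  have hu : discSeries.map (Int.castRingHom ℂ) ≠ 0 := fun h0 => by
    have := congrArg (PowerSeries.coeff 0) h0
    rw [PowerSeries.coeff_map, PowerSeries.coeff_zero_eq_constantCoeff_apply,
      constantCoeff_discSeries] at this
    simp at this
  have : jSeries.map (Int.castRingHom ℂ) = qExpansion 1 f := by
    refine mul_right_cancel₀ hu ?_
    rw [key, ← jSeries_mul_discSeries, map_mul]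
  exact this ▸ hP


lemma HasQExp.tendsto {h : ℕ} {P : PowerSeries ℂ} {f : ℍ → ℂ} (hh : 0 < h) (hf : HasQExp h P f) :
    Filter.Tendsto f atImInfty (𝓝 (P.coeff 0)) := by
  obtain ⟨F, hF, hFf⟩ := hf.exists_hasFPowerSeriesOnBall hh
  have h0 : F 0 = P.coeff 0 := by
    have := hF.hasFPowerSeriesAt.coeff_zero 1
    simpa using this.symm
  rw [funext hFf, ← h0]
  exact hF.hasFPowerSeriesAt.continuousAt.tendsto.comp
    (qParam_tendsto_atImInfty (by exact_mod_cast hh))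

/-- The modular function takes every complex value. -/
lemma exists_modularJ_eq (y : ℂ) : ∃ τ, modularJ τ = y := by
  by_contra! hy
  have hne : ∀ τ : ℍ, E₄ τ ^ 3 - y * discriminant τ ≠ 0 := fun τ h => hy τ <| by
    rw [modularJ_eq, div_eq_iff (discriminant_ne_zero τ)]
    linear_combination h
  -- If y is omitted, f = 1/(j - y) is holomorphic on ℍ, invariant, and tends to 0 at i∞. It is
  -- therefore constantly 0, which an inverse of j - y ≠ 0 cannot be.
  let f : ℍ → ℂ := fun τ => discriminant τ / (E₄ τ ^ 3 - y * discriminant τ)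
  have hfj : ∀ τ, f τ = (modularJ τ - y)⁻¹ := fun τ => by
    have := hne τ
    have := discriminant_ne_zero τ
    simp only [f, modularJ_eq]
    field_simp
  have hD : HasQExp 1 _ (fun τ => E₄ τ ^ 3 - y * discriminant τ) :=
    (hasQExp_E₄.pow 3).sub (hasQExp_discriminant.smul y)
  have ht : Filter.Tendsto f atImInfty (𝓝 0) := by
    have := (hasQExp_discriminant.tendsto one_pos).div (hD.tendsto one_pos) (by
      have : PowerSeries.constantCoeff (e4Series.map (Int.castRingHom ℂ)) = 1 := by
        rw [← PowerSeries.coeff_zero_eq_constantCoeff_apply, PowerSeries.coeff_map]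
        simp [e4Series, sigmaSeries, -zsmul_eq_mul]
      simp [this])
    simpa using! this
  obtain ⟨c, hc⟩ := eq_const_of_invariant (f := f)
    ((hasQExp_discriminant.mdifferentiable one_pos).div (hD.mdifferentiable one_pos) hne)
    (ht.isBigO_one ℝ) (fun γ τ => by rw [hfj, hfj, modularJ_smul])
  rw [funext hc, tendsto_const_nhds_iff] at ht
  have := hc UpperHalfPlane.I
  rw [hfj, ht, inv_eq_zero, sub_eq_zero] at this
  exact hy _ this

/-! ### Polynomials in `j` -/

/-- The polynomial `f` such that `f(j)` and `q⁻ᴺ P(q)` have the same polar part and the same constant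
term. -/
def jPoly {A : Type*} [CommRing A] : ℕ → PowerSeries A → A[X]
  | 0, P => Polynomial.C (P.coeff 0)
  -- Subtracting c₀ j^(N+1), with c₀ the constant coefficient of P, from q^(-N-1) P cancels the
  -- leading pole because q j has constant coefficient 1. The shift by one index turns the rest into
  -- q^(-N) times a power series.
  | N + 1, P => Polynomial.monomial (N + 1) (P.coeff 0) +
      jPoly N (PowerSeries.mk fun n =>
        (P - PowerSeries.C (P.coeff 0) * (jSeries.map (Int.castRingHom A)) ^ (N + 1)).coeff (n + 1))

section jPoly

variable {A B : Type*} [CommRing A] [CommRing B]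

/-- Only the integral series `jSeries` enters the construction, so it commutes with every ring
homomorphism. This serves both for endomorphisms of ℂ and for descent to the ring of algebraic
integers. -/
lemma jPoly_map (f : A →+* B) (N : ℕ) (P : PowerSeries A) :
    (jPoly N P).map f = jPoly N (P.map f) := by
  induction N generalizing P with
  | zero => simp [jPoly, -PowerSeries.coeff_zero_eq_constantCoeff, PowerSeries.coeff_map]
  | succ N ih =>
    rw [jPoly, jPoly, Polynomial.map_add, Polynomial.map_monomial, ih, PowerSeries.coeff_map]
    congr 2
    ext n
    have : (jSeries.map (Int.castRingHom A)).map f = jSeries.map (Int.castRingHom B) := by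
      ext n; simp [PowerSeries.coeff_map]
    rw [PowerSeries.coeff_map, PowerSeries.coeff_mk, PowerSeries.coeff_mk, ← PowerSeries.coeff_map,
      map_sub, map_mul, map_pow, this, PowerSeries.map_C]

lemma natDegree_jPoly_le (N : ℕ) (P : PowerSeries A) : (jPoly N P).natDegree ≤ N := by
  induction N generalizing P with
  | zero => simp [jPoly]
  | succ N ih =>
    rw [jPoly]
    exact Polynomial.natDegree_add_le_of_degree_le (Polynomial.natDegree_monomial_le _)
      ((ih _).trans N.le_succ)

lemma coeff_jPoly (N : ℕ) (P : PowerSeries A) : (jPoly N P).coeff N = P.coeff 0 := by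
  cases N with
  | zero => simp [jPoly]
  | succ N =>
    rw [jPoly, Polynomial.coeff_add, Polynomial.coeff_monomial_same,
      Polynomial.coeff_eq_zero_of_natDegree_lt (Nat.lt_succ_of_le (natDegree_jPoly_le _ _)),
      add_zero]

lemma jPoly_X_pow_mul (k N : ℕ) (P : PowerSeries A) :
    jPoly (N + k) (PowerSeries.X ^ k * P) = jPoly N P := by
  induction k with
  | zero => simp
  | succ k ih =>
    rw [← add_assoc, jPoly, ← ih, pow_succ', mul_assoc]
    have h0 : (PowerSeries.X * (PowerSeries.X ^ k * P)).coeff 0 = 0 := by simp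
    rw [h0]
    simp only [map_zero, zero_mul, sub_zero, zero_add]
    congr 1
    ext n
    rw [PowerSeries.coeff_mk, PowerSeries.coeff_succ_X_mul]

end jPoly

lemma HasQExp.of_X_mul {h : ℕ} {P : PowerSeries ℂ} {f : ℍ → ℂ}
    (hf : HasQExp h (PowerSeries.X * P) (fun τ => Periodic.qParam h τ * f τ)) : HasQExp h P f := by
  intro τ
  have h1 := (hasSum_nat_add_iff' 1).2 (hf τ)
  simp only [PowerSeries.coeff_succ_X_mul, Finset.range_one, Finset.sum_singleton,
    PowerSeries.coeff_zero_X_mul, zero_mul, sub_zero] at h1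
  have h2 := h1.mul_left (Periodic.qParam h τ)⁻¹
  have hq := Periodic.qParam_ne_zero (h := h) (τ : ℂ)
  rw [inv_mul_cancel_left₀ hq] at h2
  convert! h2 using 2 with n
  field_simp
  ring

/-- An invariant function with a pole of order at most `N` at `i∞` is a polynomial in `j`. -/
lemma eq_eval_jPoly {N : ℕ} {P : PowerSeries ℂ} {F : ℍ → ℂ}
    (hF : HasQExp 1 P (fun τ => Periodic.qParam 1 τ ^ N * F τ))
    (hinv : ∀ (γ : SL(2, ℤ)) (τ : ℍ), F (γ • τ) = F τ) (τ : ℍ) :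
    F τ = (jPoly N P).eval (modularJ τ) := by
  induction N generalizing P F with
  | zero =>
    simp only [pow_zero, one_mul] at hF
    have := (hF.sub (HasQExp.const 1 (P.coeff 0))).eq_zero_of_invariant (by simp)
      (fun γ τ => by rw [Pi.sub_apply, Pi.sub_apply, hinv]) τ
    simpa [jPoly, sub_eq_zero] using this
  | succ N ih =>
    set P' : PowerSeries ℂ := PowerSeries.mk fun n =>
      (P - PowerSeries.C (P.coeff 0) * (jSeries.map (Int.castRingHom ℂ)) ^ (N + 1)).coeff (n + 1)
      with hP'
    have hXP : PowerSeries.X * P' =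
        P - PowerSeries.C (P.coeff 0) * (jSeries.map (Int.castRingHom ℂ)) ^ (N + 1) := by
      ext n
      cases n with
      | zero =>
        have : PowerSeries.constantCoeff (jSeries.map (Int.castRingHom ℂ)) = 1 := by
          rw [← PowerSeries.coeff_zero_eq_constantCoeff_apply, PowerSeries.coeff_map,
            jSeries_coeff_zero, map_one]
        simp [this]
      | succ n => rw [PowerSeries.coeff_succ_X_mul, hP', PowerSeries.coeff_mk]
    have h1 : HasQExp 1 P' (fun τ => Periodic.qParam 1 τ ^ N *
        (F τ - P.coeff 0 * modularJ τ ^ (N + 1))) := by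
      refine HasQExp.of_X_mul ?_
      rw [hXP]
      convert! hF.sub ((hasQExp_modularJ.pow (N + 1)).smul (P.coeff 0)) using 1
      ext τ
      simp only [Pi.sub_apply, Pi.pow_apply, Nat.cast_one]
      ring
    have h2 := ih h1 (fun γ τ => by rw [hinv, modularJ_smul])
    rw [jPoly, Polynomial.eval_add, Polynomial.eval_monomial, ← hP', ← h2]
    ring

/-! ### The lattice is determined by its invariants -/

open scoped PeriodPair in
-- With ℘ = z⁻² + f, where f is regular at 0, the equation ℘'² = 4℘³ - g₂℘ - g₃ multiplied by z⁶
-- becomes an equation without poles.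
lemma PeriodPair.weierstrassPExcept_zero_equation (L : PeriodPair) : ∀ᶠ z in 𝓝[≠] (0 : ℂ),
    (z ^ 3 * deriv (L.weierstrassPExcept 0) z - 2) ^ 2
      = 4 * (z ^ 2 * L.weierstrassPExcept 0 z + 1) ^ 3
        - L.g₂ * z ^ 4 * (z ^ 2 * L.weierstrassPExcept 0 z + 1) - L.g₃ * z ^ 6 := by
  filter_upwards [self_mem_nhdsWithin,
    nhdsWithin_le_nhds (L.compl_lattice_sdiff_singleton_mem_nhds 0)] with z hz0 hz
  have hz0' : z ≠ 0 := hz0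
  have hzL : z ∉ L.lattice := fun h => hz ⟨h, hz0⟩
  have h1 := L.weierstrassPExcept_add 0 z
  have h2 := L.derivWeierstrassPExcept_sub 0 z
  have h3 := L.derivWeierstrassP_sq z hzL
  rw [← h1, ← h2] at h3
  simp only [ZeroMemClass.coe_zero, sub_zero] at h3
  rw [L.eqOn_deriv_weierstrassPExcept_derivWeierstrassPExcept 0 hz]
  have h4 := congrArg (· * z ^ 6) h3
  simp only [ne_eq, OfNat.ofNat_ne_zero, not_false_eq_true, zero_pow, div_zero, sub_zero] at h4
  field_simp at h4
  linear_combination h4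

/-- Both regular parts solve the same differential equation. If they differed by zⁿg with g(0) ≠ 0,
subtracting the equations, dividing by z^(n+2) and letting z → 0 would give -4n g(0) = 12 g(0),
which is impossible. -/
lemma PeriodPair.weierstrassPExcept_zero_eventuallyEq {L L' : PeriodPair} (h2 : L.g₂ = L'.g₂)
    (h3 : L.g₃ = L'.g₃) : ∀ᶠ z in 𝓝 (0 : ℂ),
      L.weierstrassPExcept 0 z - L'.weierstrassPExcept 0 z = 0 := by
  set f := L.weierstrassPExcept 0 with hf
  set f' := L'.weierstrassPExcept 0 with hf'
  have haf : AnalyticAt ℂ f 0 := L.analyticAt_weierstrassPExcept 0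
  have haf' : AnalyticAt ℂ f' 0 := L'.analyticAt_weierstrassPExcept 0
  by_contra hne
  obtain ⟨n, g, hg, hg0, hgz⟩ := (haf.sub haf').exists_eventuallyEq_pow_smul_nonzero_iff.2 hne
  simp only [sub_zero, smul_eq_mul] at hgz
  have hd : ∀ᶠ z in 𝓝 (0 : ℂ), z * (deriv f z - deriv f' z) = z ^ n * (n * g z + z * deriv g z) := by
    have hgz' : (fun z => f z - f' z) =ᶠ[𝓝 0] fun z => z ^ n * g z := hgz
    filter_upwards [hgz'.deriv, hg.eventually_analyticAt, haf.eventually_analyticAt,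
      haf'.eventually_analyticAt] with z h1 h2 h3 h4
    rw [deriv_fun_sub h3.differentiableAt h4.differentiableAt,
      deriv_fun_mul (by fun_prop) h2.differentiableAt] at h1
    rw [h1]
    cases n with
    | zero => simp
    | succ n => simp; ring
  let l : ℂ → ℂ := fun z => (n * g z + z * deriv g z) * (z ^ 3 * (deriv f z + deriv f' z) - 4)
  let r : ℂ → ℂ := fun z => g z * (4 * ((z ^ 2 * f z + 1) ^ 2
    + (z ^ 2 * f z + 1) * (z ^ 2 * f' z + 1) + (z ^ 2 * f' z + 1) ^ 2) - L.g₂ * z ^ 4)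
  have hlr : l =ᶠ[𝓝[≠] 0] r := by
    filter_upwards [self_mem_nhdsWithin, L.weierstrassPExcept_zero_equation,
      L'.weierstrassPExcept_zero_equation, nhdsWithin_le_nhds hd, nhdsWithin_le_nhds hgz]
      with z hz0 e1 e2 e3 e4
    have hz0' : z ≠ 0 := hz0
    rw [← h2, ← h3] at e2
    refine mul_left_cancel₀ (pow_ne_zero (n + 2) hz0') ?_
    simp only [l, r]
    simp only [Pi.sub_apply] at e4
    rw [← hf] at e1
    rw [← hf'] at e2
    linear_combination e1 - e2
      - z ^ 2 * (z ^ 3 * (deriv f z + deriv f' z) - 4) * e3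
      + z ^ 2 * (4 * ((z ^ 2 * f z + 1) ^ 2
        + (z ^ 2 * f z + 1) * (z ^ 2 * f' z + 1) + (z ^ 2 * f' z + 1) ^ 2) - L.g₂ * z ^ 4) * e4
  have hgc := hg.continuousAt
  have hgc' := hg.deriv.continuousAt
  have hfc := haf.continuousAt
  have hfc' := haf.deriv.continuousAt
  have hkc := haf'.continuousAt
  have hkc' := haf'.deriv.continuousAt
  have hl : ContinuousAt l 0 := by fun_prop
  have hr : ContinuousAt r 0 := by fun_prop
  have := ((hl.eventuallyEq_nhds_iff_eventuallyEq_nhdsNE hr).1 hlr).eq_of_nhds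
  simp only [l, r] at this
  have h0 : ((n : ℂ) + 3) * g 0 = 0 := by linear_combination (-1 / 4) * this
  rcases mul_eq_zero.1 h0 with h | h
  · exact absurd h (by exact_mod_cast Nat.succ_ne_zero (n + 2))
  · exact hg0 h

lemma PeriodPair.countable_lattice (L : PeriodPair) : (L.lattice : Set ℂ).Countable :=
  Set.countable_coe_iff.1 (L.latticeEquivProd.toEquiv.countable_iff.2 inferInstance)

/-- The two ℘-functions agree near 0, hence on the complement of both lattices, which is connected
as the complement of a countable set. A point of the first lattice outside the second would be a
pole of one function and a regular point of the other. -/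
lemma PeriodPair.lattice_le_of_invariants_eq {L L' : PeriodPair} (h2 : L.g₂ = L'.g₂)
    (h3 : L.g₃ = L'.g₃) : L.lattice ≤ L'.lattice := by
  set U : Set ℂ := ((L.lattice : Set ℂ) ∪ L'.lattice)ᶜ with hU
  have hUo : IsOpen U := (L.isClosed_lattice.union L'.isClosed_lattice).isOpen_compl
  have hUc : IsPreconnected U :=
    ((L.countable_lattice.union L'.countable_lattice).isPathConnected_compl_of_one_lt_rank
      (by simp [Complex.rank_real_complex])).isConnected.isPreconnected
  have hnear : ∀ᶠ z in 𝓝[≠] (0 : ℂ), z ∈ U ∧ L.weierstrassP =ᶠ[𝓝 z] L'.weierstrassP := by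
    have h := weierstrassPExcept_zero_eventuallyEq h2 h3
    filter_upwards [nhdsWithin_le_nhds h.eventually_nhds, self_mem_nhdsWithin,
      nhdsWithin_le_nhds (L.compl_lattice_sdiff_singleton_mem_nhds 0),
      nhdsWithin_le_nhds (L'.compl_lattice_sdiff_singleton_mem_nhds 0)] with z hz hz0 hzL hzL'
    refine ⟨fun h => h.elim (fun h => hzL ⟨h, hz0⟩) (fun h => hzL' ⟨h, hz0⟩), ?_⟩
    filter_upwards [hz] with w hw
    rw [← L.weierstrassPExcept_add 0 w, ← L'.weierstrassPExcept_add 0 w]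
    simp only [ZeroMemClass.coe_zero]
    rw [sub_eq_zero.1 hw]
  obtain ⟨z₀, hz₀, hz₀'⟩ := hnear.exists
  have heq : Set.EqOn L.weierstrassP L'.weierstrassP U :=
    (L.analyticOnNhd_weierstrassP.mono (by intro z hz h; exact hz (Or.inl h)))
      |>.eqOn_of_preconnected_of_eventuallyEq
      (L'.analyticOnNhd_weierstrassP.mono (by intro z hz h; exact hz (Or.inr h))) hUc hz₀ hz₀'
  intro l hl
  by_contra hl'
  have hev : L.weierstrassP =ᶠ[𝓝[≠] l] L'.weierstrassP := by
    filter_upwards [self_mem_nhdsWithin,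
      nhdsWithin_le_nhds (L.compl_lattice_sdiff_singleton_mem_nhds l),
      nhdsWithin_le_nhds (L'.isClosed_lattice.isOpen_compl.mem_nhds hl')] with z hz0 hzL hzL'
    exact heq fun h => h.elim (fun h => hzL ⟨h, hz0⟩) (fun h => hzL' h)
  have h1 := L.order_weierstrassP l hl
  rw [meromorphicOrderAt_congr hev] at h1
  have h4 := (L'.analyticOnNhd_weierstrassP l hl').meromorphicOrderAt_nonneg
  rw [h1] at h4
  exact absurd h4 (by decide)

lemma PeriodPair.lattice_eq_of_invariants_eq {L L' : PeriodPair} (h2 : L.g₂ = L'.g₂)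
    (h3 : L.g₃ = L'.g₃) : L.lattice = L'.lattice :=
  le_antisymm (lattice_le_of_invariants_eq h2 h3) (lattice_le_of_invariants_eq h2.symm h3.symm)

/-- Two pairs of invariants with the same `j` differ by a scaling. -/
lemma exists_scaling_of_j_eq {a b a' b' : ℂ} (h : a ^ 3 - 27 * b ^ 2 ≠ 0)
    (h' : a' ^ 3 - 27 * b' ^ 2 ≠ 0)
    (hj : a ^ 3 / (a ^ 3 - 27 * b ^ 2) = a' ^ 3 / (a' ^ 3 - 27 * b' ^ 2)) :
    ∃ z : ℂ, z ≠ 0 ∧ a = z ^ 4 * a' ∧ b = z ^ 6 * b' := by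
  have key : a ^ 3 * b' ^ 2 = a' ^ 3 * b ^ 2 := by
    rw [div_eq_div_iff h h'] at hj
    linear_combination (-1 / 27) * hj
  -- In general z² = b a' / (b' a) works. When a = 0 or b = 0 this quotient degenerates, and z is a
  -- sixth root of b/b' or a fourth root of a/a' instead.
  by_cases ha : a = 0
  · have hb : b ≠ 0 := by rintro rfl; simp [ha] at h
    have ha' : a' = 0 := by simpa [ha, hb] using key
    have hb' : b' ≠ 0 := by rintro rfl; simp [ha'] at h'
    obtain ⟨z, hz⟩ := IsAlgClosed.exists_pow_nat_eq (b / b') (n := 6) (by norm_num)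
    refine ⟨z, ?_, by simp [ha, ha'], by rw [hz]; field_simp⟩
    rintro rfl
    simp [hb, hb', eq_comm] at hz
  have ha' : a' ≠ 0 := by
    rintro rfl
    have : b' ≠ 0 := by rintro rfl; simp at h'
    simp [ha, this] at key
  by_cases hb : b = 0
  · have hb' : b' = 0 := by simpa [hb, ha] using key
    obtain ⟨z, hz⟩ := IsAlgClosed.exists_pow_nat_eq (a / a') (n := 4) (by norm_num)
    refine ⟨z, ?_, by rw [hz]; field_simp, by simp [hb, hb']⟩
    rintro rfl
    simp [ha, ha', eq_comm] at hz
  have hb' : b' ≠ 0 := by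
    rintro rfl
    simp [ha', hb] at key
  obtain ⟨z, hz⟩ := IsAlgClosed.exists_pow_nat_eq (b * a' / (b' * a)) (n := 2) (by norm_num)
  have h4 : a = z ^ 4 * a' := by
    rw [show z ^ 4 = (z ^ 2) ^ 2 by ring, hz]
    field_simp
    linear_combination key
  refine ⟨z, ?_, h4, ?_⟩
  · rintro rfl
    simp [ha, ha', hb, hb', eq_comm] at hz
  · have : z ^ 4 = a / a' := by rw [h4]; field_simp
    rw [show z ^ 6 = z ^ 2 * z ^ 4 by ring, hz, this]
    field_simp

/-- Lattices with the same invariant are homothetic. -/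
lemma exists_homothety_of_modularJ_eq {τ τ' : ℍ} (h : modularJ τ = modularJ τ') :
    ∃ z : ℂ, z ≠ 0 ∧ ∀ w, w ∈ upperLattice τ' ↔ ∃ v ∈ upperLattice τ, w = z * v := by
  have hj : latticeJ (upperLattice τ) = latticeJ (upperLattice τ') := h
  obtain ⟨z, hz, h2, h3⟩ := exists_scaling_of_j_eq (latticeDisc_upperLattice_ne_zero τ)
    (latticeDisc_upperLattice_ne_zero τ') (by
      unfold latticeJ at hj
      rw [mul_div_assoc, mul_div_assoc] at hj
      exact mul_left_cancel₀ (by norm_num) hj)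
  have hind : LinearIndependent ℝ ![z * τ, z] := by
    refine LinearIndependent.pair_iff.2 fun s t h => ?_
    refine LinearIndependent.pair_iff.1 (linearIndependent_pair_of_im_ne_zero τ.im_ne_zero) s t ?_
    refine mul_left_cancel₀ hz ?_
    simp only [real_smul] at h ⊢
    linear_combination h
  -- The scaling factor z was chosen so that z(ℤτ + ℤ) has the same g₂ and g₃ as ℤτ' + ℤ.
  let L : PeriodPair := ⟨z * τ, z, hind⟩
  have hmem : ∀ w, w ∈ L.lattice ↔ ∃ v ∈ upperLattice τ, w = z * v := fun w => by
    rw [PeriodPair.mem_lattice]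
    constructor
    · rintro ⟨m, n, rfl⟩
      exact ⟨m * τ + n, mem_upperLattice.2 ⟨m, n, rfl⟩, by simp only [L]; ring⟩
    · rintro ⟨v, hv, rfl⟩
      obtain ⟨m, n, rfl⟩ := mem_upperLattice.1 hv
      exact ⟨m, n, by simp only [L]; ring⟩
  have e2 : L.g₂ = (upperPeriodPair τ').g₂ := by
    change 60 * latticeG L.lattice 4 = latticeG2 (upperLattice τ')
    rw [latticeG_smul _ _ z hz hmem]
    have : latticeG2 (upperLattice τ') = (z ^ 4)⁻¹ * latticeG2 (upperLattice τ) := by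
      rw [h2]; field_simp
    rw [this, latticeG2]; ring
  have e3 : L.g₃ = (upperPeriodPair τ').g₃ := by
    change 140 * latticeG L.lattice 6 = latticeG3 (upperLattice τ')
    rw [latticeG_smul _ _ z hz hmem]
    have : latticeG3 (upperLattice τ') = (z ^ 6)⁻¹ * latticeG3 (upperLattice τ) := by
      rw [h3]; field_simp
    rw [this, latticeG3]; ring
  refine ⟨z, hz, fun w => ?_⟩
  rw [← hmem, PeriodPair.lattice_eq_of_invariants_eq e2 e3]
  rfl

/-! ### Sublattices of given index -/

/-- The invariant of the lattice spanned by `M (τ, 1)`. -/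
def matrixJ (M : Matrix (Fin 2) (Fin 2) ℤ) (τ : ℍ) : ℂ :=
  latticeJ (Submodule.span ℤ {(M 0 0 * τ + M 0 1 : ℂ), (M 1 0 * τ + M 1 1 : ℂ)})

lemma span_pair_eq_of_det_eq_one (x y : ℂ) {p q r s : ℤ} (h : p * s - q * r = 1) :
    Submodule.span ℤ {p * x + q * y, r * x + s * y} = Submodule.span ℤ {x, y} := by
  have h' : (p * s - q * r : ℂ) = 1 := by exact_mod_cast h
  apply le_antisymm
  · rw [Submodule.span_le]
    rintro _ (rfl | rfl)
    · exact Submodule.mem_span_pair.2 ⟨p, q, by simp⟩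
    · exact Submodule.mem_span_pair.2 ⟨r, s, by simp⟩
  · rw [Submodule.span_le]
    rintro w (hw | hw)
    · refine Submodule.mem_span_pair.2 ⟨s, -q, ?_⟩
      simp only [hw, zsmul_eq_mul]; push_cast
      linear_combination x * h'
    · refine Submodule.mem_span_pair.2 ⟨-r, p, ?_⟩
      simp only [Set.mem_singleton_iff.1 hw, zsmul_eq_mul]; push_cast
      linear_combination y * h'

lemma matrixJ_mul_left (γ : SL(2, ℤ)) (M : Matrix (Fin 2) (Fin 2) ℤ) (τ : ℍ) :
    matrixJ (γ.1 * M) τ = matrixJ M τ := by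
  have hdet : γ.1 0 0 * γ.1 1 1 - γ.1 0 1 * γ.1 1 0 = 1 := by
    rw [← Matrix.det_fin_two]; exact γ.2
  rw [matrixJ, matrixJ, ← span_pair_eq_of_det_eq_one (M 0 0 * τ + M 0 1 : ℂ)
    (M 1 0 * τ + M 1 1 : ℂ) hdet]
  congr 3
  · simp [Matrix.mul_apply, Fin.sum_univ_two]; ring
  · simp [Matrix.mul_apply, Fin.sum_univ_two]; ring

lemma denom_intCast_ne_zero (γ : SL(2, ℤ)) (τ : ℍ) : (γ.1 1 0 : ℂ) * τ + γ.1 1 1 ≠ 0 := by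
  have := UpperHalfPlane.denom_ne_zero (γ : GL (Fin 2) ℝ) τ
  simpa [UpperHalfPlane.denom] using this

/-- Up to the automorphy factor, a homothety, the basis (γτ, 1) is γ applied to (τ, 1). Together
with `matrixJ_mul_left` this lets SL(2, ℤ) act on the left classes of matrices of determinant m. -/
lemma matrixJ_smul (γ : SL(2, ℤ)) (M : Matrix (Fin 2) (Fin 2) ℤ) (τ : ℍ) :
    matrixJ M (γ • τ) = matrixJ (M * γ.1) τ := by
  have hne := denom_intCast_ne_zero γ τ
  have hτ : ((γ • τ : ℍ) : ℂ) = (γ.1 0 0 * τ + γ.1 0 1) / (γ.1 1 0 * τ + γ.1 1 1) := by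
    rw [UpperHalfPlane.specialLinearGroup_apply]
    simp
  have key : ∀ k l : ℤ, (k * (γ • τ : ℍ) + l : ℂ) = (γ.1 1 0 * τ + γ.1 1 1 : ℂ)⁻¹ *
      ((k * γ.1 0 0 + l * γ.1 1 0 : ℤ) * τ + (k * γ.1 0 1 + l * γ.1 1 1 : ℤ)) := fun k l => by
    rw [hτ, mul_comm _⁻¹, ← div_eq_mul_inv, eq_div_iff hne, add_mul, mul_assoc,
      div_mul_cancel₀ _ hne]
    push_cast
    ring
  refine latticeJ_smul _ _ (γ.1 1 0 * τ + γ.1 1 1 : ℂ)⁻¹ (inv_ne_zero hne) fun w => ?_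
  simp only [Matrix.mul_apply, Fin.sum_univ_two, Submodule.mem_span_pair, zsmul_eq_mul, key]
  constructor
  · rintro ⟨x, y, rfl⟩
    exact ⟨_, ⟨x, y, rfl⟩, by ring⟩
  · rintro ⟨_, ⟨x, y, rfl⟩, rfl⟩
    exact ⟨x, y, by ring⟩

/-- A matrix in Hermite normal form with determinant `m`, not a scalar matrix. -/
@[ext]
structure HeckeTriple (m : ℕ) where
  /-- the upper left entry -/
  a : ℕ
  /-- the upper right entry -/
  b : ℕ
  /-- the lower right entry -/
  d : ℕ
  mul_eq : a * d = m
  b_lt : b < d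
  not_scalar : ¬ (a = d ∧ b = 0)

namespace HeckeTriple

variable {m : ℕ}

/-- The matrix of a triple. -/
def mat (t : HeckeTriple m) : Matrix (Fin 2) (Fin 2) ℤ := !![(t.a : ℤ), t.b; 0, t.d]

lemma d_pos (t : HeckeTriple m) : 0 < t.d := (Nat.zero_le _).trans_lt t.b_lt

lemma a_pos (hm : m ≠ 0) (t : HeckeTriple m) : 0 < t.a :=
  Nat.pos_of_ne_zero fun h => hm (by rw [← t.mul_eq, h, zero_mul])

lemma a_le (hm : m ≠ 0) (t : HeckeTriple m) : t.a ≤ m :=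
  Nat.le_of_dvd (Nat.pos_of_ne_zero hm) ⟨t.d, t.mul_eq.symm⟩

lemma d_le (hm : m ≠ 0) (t : HeckeTriple m) : t.d ≤ m :=
  Nat.le_of_dvd (Nat.pos_of_ne_zero hm) ⟨t.a, by rw [mul_comm, t.mul_eq]⟩

lemma finite (hm : m ≠ 0) : Finite (HeckeTriple m) := by
  refine Finite.of_injective (β := Fin (m + 1) × Fin (m + 1) × Fin (m + 1))
    (fun t => (⟨t.a, Nat.lt_succ_of_le (t.a_le hm)⟩,
      ⟨t.b, Nat.lt_succ_of_le (t.b_lt.le.trans (t.d_le hm))⟩,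
      ⟨t.d, Nat.lt_succ_of_le (t.d_le hm)⟩)) fun t t' h => ?_
  simp only [Prod.mk.injEq, Fin.mk.injEq] at h
  exact HeckeTriple.ext h.1 h.2.1 h.2.2

end HeckeTriple

open FixedDetMatrices in
lemma exists_reduce_eq_smul {m : ℤ} (A : FixedDetMatrix (Fin 2) ℤ m) :
    ∃ δ : SL(2, ℤ), reduce A = δ • A := by
  induction A using reduce_rec with
  | base A h =>
    by_cases ha : 0 < A.1 0 0
    · exact ⟨_, reduce_of_pos h ha⟩
    · exact ⟨_, by rw [reduce_of_not_pos h ha, ← mul_smul, ← mul_smul]⟩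
  | step A h ih =>
    obtain ⟨δ, hδ⟩ := ih
    rw [reduce_reduceStep h] at hδ
    exact ⟨_, by rw [hδ, reduceStep, ← mul_smul, ← mul_smul]⟩

/-- Hermite normal form. -/
lemma exists_hermite {m : ℕ} (hm : m ≠ 0) (M : Matrix (Fin 2) (Fin 2) ℤ) (hM : M.det = m) :
    ∃ (δ : SL(2, ℤ)) (a b d : ℕ), a * d = m ∧ b < d ∧ δ.1 * M = !![(a : ℤ), b; 0, d] := by
  have hm' : (m : ℤ) ≠ 0 := by exact_mod_cast hm
  obtain ⟨δ, hδ⟩ := exists_reduce_eq_smul (⟨M, hM⟩ : FixedDetMatrix (Fin 2) ℤ m)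
  obtain ⟨h10, h00, h01, h11⟩ := FixedDetMatrices.reduce_mem_reps hm' ⟨M, hM⟩
  set A := FixedDetMatrices.reduce (⟨M, hM⟩ : FixedDetMatrix (Fin 2) ℤ m)
  have hdet : A.1 0 0 * A.1 1 1 = m := by
    have := A.2
    rw [Matrix.det_fin_two, h10] at this
    linarith
  have hd : 0 < A.1 1 1 := by
    have : 0 < A.1 0 0 * A.1 1 1 := by rw [hdet]; positivity
    exact (mul_pos_iff_of_pos_left h00).1 this
  rw [abs_of_nonneg h01, abs_of_pos hd] at h11
  refine ⟨δ, (A.1 0 0).toNat, (A.1 0 1).toNat, (A.1 1 1).toNat, ?_, ?_, ?_⟩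
  · zify
    rw [Int.toNat_of_nonneg h00.le, Int.toNat_of_nonneg hd.le, hdet]
  · zify
    rw [Int.toNat_of_nonneg h01, Int.toNat_of_nonneg hd.le]
    exact h11
  · rw [Int.toNat_of_nonneg h00.le, Int.toNat_of_nonneg h01, Int.toNat_of_nonneg hd.le, ← h10,
      ← Matrix.eta_fin_two, hδ]
    rfl

/-- The first column forces δ to be upper triangular, and positivity makes its diagonal 1; then b
and b' are residues modulo the same d in [0, d), so the corner of δ is 0. -/
lemma hermite_unique {a b d a' b' d' : ℕ} (ha : 0 < a) (ha' : 0 < a') (hb : b < d) (hb' : b' < d')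
    (δ : SL(2, ℤ)) (h : δ.1 * !![(a : ℤ), b; 0, d] = !![(a' : ℤ), b'; 0, d']) :
    a = a' ∧ b = b' ∧ d = d' := by
  have hdet : δ.1 0 0 * δ.1 1 1 - δ.1 0 1 * δ.1 1 0 = 1 := by
    rw [← Matrix.det_fin_two]; exact δ.2
  have e00 := congrFun (congrFun h 0) 0
  have e01 := congrFun (congrFun h 0) 1
  have e10 := congrFun (congrFun h 1) 0
  have e11 := congrFun (congrFun h 1) 1
  simp [Matrix.mul_apply, Fin.sum_univ_two] at e00 e01 e10 e11
  have hr : δ.1 1 0 = 0 := by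
    rcases e10 with h | h
    · exact h
    · omega
  rw [hr] at hdet e11
  set p := δ.1 0 0
  set q := δ.1 0 1
  set s := δ.1 1 1
  have hps : p * s = 1 := by linarith
  have hp : 0 < p := by
    by_contra hp
    have : p * a ≤ 0 := mul_nonpos_of_nonpos_of_nonneg (not_lt.1 hp) (by positivity)
    omega
  have hp1 : p = 1 := by
    rcases Int.eq_one_or_neg_one_of_mul_eq_one hps with h | h <;> omega
  have hs1 : s = 1 := by rw [hp1, one_mul] at hps; exact hps
  rw [hp1, one_mul] at e00 e01
  rw [hs1, one_mul, zero_mul, zero_add] at e11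
  have hq : q = 0 := by
    by_contra hq
    rcases lt_or_gt_of_ne hq with h | h <;> nlinarith
  rw [hq, zero_mul, add_zero] at e01
  omega

/-! ### Multipliers of a lattice -/

/-- The complex numbers `x` with `x Λ ⊆ Λ`. -/
def multipliers (Λ : Submodule ℤ ℂ) : Set ℂ := {x | ∀ v ∈ Λ, x * v ∈ Λ}

lemma mem_multipliers_upperLattice {τ : ℍ} {x : ℂ} : x ∈ multipliers (upperLattice τ) ↔
    ∃ M : Matrix (Fin 2) (Fin 2) ℤ, x * τ = M 0 0 * τ + M 0 1 ∧ x = M 1 0 * τ + M 1 1 := by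
  constructor
  · intro h
    obtain ⟨a, b, hab⟩ := mem_upperLattice.1 (h τ (mem_upperLattice.2 ⟨1, 0, by simp⟩))
    obtain ⟨c, d, hcd⟩ := mem_upperLattice.1 (h 1 (mem_upperLattice.2 ⟨0, 1, by simp⟩))
    exact ⟨!![a, b; c, d], by simpa using hab, by simpa using hcd⟩
  · rintro ⟨M, h1, h2⟩ v hv
    obtain ⟨k, l, rfl⟩ := mem_upperLattice.1 hv
    refine mem_upperLattice.2 ⟨k * M 0 0 + l * M 1 0, k * M 0 1 + l * M 1 1, ?_⟩
    push_cast
    linear_combination k * h1 + l * h2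

/-- M represents multiplication by x on the real plane ℂ in the basis τ, 1, and that map has
determinant |x|². -/
lemma det_eq_normSq {τ : ℍ} {x : ℂ} {M : Matrix (Fin 2) (Fin 2) ℤ}
    (h1 : x * τ = M 0 0 * τ + M 0 1) (h2 : x = M 1 0 * τ + M 1 1) :
    (M.det : ℝ) = Complex.normSq x := by
  have e1 := congrArg Complex.re h1
  have e2 := congrArg Complex.im h1
  have e3 := congrArg Complex.re h2
  have e4 := congrArg Complex.im h2
  simp at e1 e2 e3 e4
  have hτ : τ.im ≠ 0 := τ.im_ne_zero
  rw [Matrix.det_fin_two, Complex.normSq_apply]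
  push_cast
  refine mul_right_cancel₀ hτ ?_
  rw [e3, e4] at e2 ⊢
  have : (M 0 0 : ℝ) = 2 * (M 1 0 * τ.re) + M 1 1 := by
    refine mul_right_cancel₀ hτ ?_
    linear_combination -e2
  rw [e3, e4] at e1
  linear_combination τ.im * M 1 1 * this + M 1 0 * τ.im * e1 + M 1 0 * τ.im * τ.re * this

/-- The norms of the elements of `O` that are not the product of an integer and an element of
norm `1`. -/
def normSet (O : Set ℂ) : Set ℕ :=
  {m | ∃ x ∈ O, Complex.normSq x = m ∧ ∀ s : ℤ, ∀ u ∈ O, Complex.normSq u = 1 → x ≠ s * u}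

/-- The product of the differences `j(Λ) - j(Λ')`, over the sublattices `Λ'` of index `m` in
`Λ = ℤ τ + ℤ` that are not of the form `s Λ`. -/
def heckeProduct (m : ℕ) (τ : ℍ) : ℂ := ∏ᶠ t : HeckeTriple m, (modularJ τ - matrixJ t.mat τ)

/-- Sending t to the Hermite form of t γ permutes the triples, and the factors are permuted
accordingly. -/
lemma heckeProduct_smul {m : ℕ} (hm : m ≠ 0) (γ : SL(2, ℤ)) (τ : ℍ) :
    heckeProduct m (γ • τ) = heckeProduct m τ := by
  have := HeckeTriple.finite hm
  have key : ∀ t : HeckeTriple m, ∃ t' : HeckeTriple m, ∃ δ : SL(2, ℤ),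
      δ.1 * (t.mat * γ.1) = t'.mat := by
    intro t
    obtain ⟨δ, a, b, d, had, hbd, h⟩ := exists_hermite hm (t.mat * γ.1) (by
      rw [Matrix.det_mul, γ.2, mul_one, HeckeTriple.mat, Matrix.det_fin_two]
      simp only [Matrix.of_apply, Matrix.cons_val', Matrix.cons_val_zero, Matrix.cons_val_one,
        Matrix.cons_val_fin_one, mul_zero, sub_zero]
      exact_mod_cast t.mul_eq)
    refine ⟨⟨a, b, d, had, hbd, ?_⟩, δ, h⟩
    rintro ⟨rfl, rfl⟩
    have hsc : !![(a : ℤ), (0 : ℕ); 0, a] = (a : ℤ) • (1 : Matrix (Fin 2) (Fin 2) ℤ) := by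
      ext i j; fin_cases i <;> fin_cases j <;> simp
    have hγ : γ.1 * (γ⁻¹).1 = 1 := by
      rw [← Matrix.SpecialLinearGroup.coe_mul, mul_inv_cancel, Matrix.SpecialLinearGroup.coe_one]
    -- A scalar matrix commutes with γ, so a scalar Hermite form of t γ would make t itself
    -- left-equivalent to a scalar matrix.
    have h2 : (γ * δ).1 * t.mat = !![(a : ℤ), (0 : ℕ); 0, a] := by
      rw [hsc] at h ⊢
      have := congrArg (fun X => γ.1 * X * (γ⁻¹).1) h
      simp only [mul_smul_comm, smul_mul_assoc, mul_one, hγ] at this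
      rw [← this, Matrix.SpecialLinearGroup.coe_mul]
      simp only [mul_assoc, hγ, mul_one]
    obtain ⟨h3, h4, h5⟩ := hermite_unique (t.a_pos hm)
      (Nat.pos_of_ne_zero fun h => hm (by rw [← had, h, zero_mul])) t.b_lt hbd _ h2
    exact t.not_scalar ⟨h3.trans h5.symm, h4⟩
  choose e δ he using key
  have hinj : Function.Injective e := by
    intro t t' htt'
    have h1 := he t
    have h2 := he t'
    rw [← htt', ← h1, ← mul_assoc, ← mul_assoc] at h2
    have hγ : γ.1 * (γ⁻¹).1 = 1 := by
      rw [← Matrix.SpecialLinearGroup.coe_mul, mul_inv_cancel, Matrix.SpecialLinearGroup.coe_one]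
    have hδ : ((δ t)⁻¹).1 * (δ t).1 = 1 := by
      rw [← Matrix.SpecialLinearGroup.coe_mul, inv_mul_cancel, Matrix.SpecialLinearGroup.coe_one]
    have h3 := congrArg (fun X => ((δ t)⁻¹).1 * (X * (γ⁻¹).1)) h2
    simp only [mul_assoc, hγ, mul_one] at h3
    rw [← mul_assoc _ (δ t).1, hδ, one_mul, ← mul_assoc, ← Matrix.SpecialLinearGroup.coe_mul] at h3
    obtain ⟨h4, h5, h6⟩ := hermite_unique (t'.a_pos hm) (t.a_pos hm) t'.b_lt t.b_lt _ h3
    exact HeckeTriple.ext h4.symm h5.symm h6.symm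
  have hbij : Function.Bijective e := Finite.injective_iff_bijective.1 hinj
  refine finprod_eq_of_bijective e hbij fun t => ?_
  rw [modularJ_smul, matrixJ_smul, ← he, matrixJ_mul_left]

/-- The point `(a τ + b) / d`. -/
def HeckeTriple.point {m : ℕ} (hm : m ≠ 0) (t : HeckeTriple m) (τ : ℍ) : ℍ :=
  ⟨(t.a * τ + t.b) / t.d, by
    have h1 : (0 : ℝ) < t.a := by exact_mod_cast t.a_pos hm
    have h2 : (0 : ℝ) < t.d := by exact_mod_cast t.d_pos
    have := τ.im_pos
    simp only [Complex.div_natCast_im, Complex.add_im, Complex.mul_im, Complex.natCast_re,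
      Complex.natCast_im, zero_mul, add_zero, coe_im]
    positivity⟩

lemma HeckeTriple.mem_span_iff {m : ℕ} (hm : m ≠ 0) (t : HeckeTriple m) (τ : ℍ) (w : ℂ) :
    w ∈ Submodule.span ℤ {(t.mat 0 0 * τ + t.mat 0 1 : ℂ), (t.mat 1 0 * τ + t.mat 1 1 : ℂ)} ↔
      ∃ v ∈ upperLattice (t.point hm τ), w = t.d * v := by
  have hd : (t.d : ℂ) ≠ 0 := by exact_mod_cast t.d_pos.ne'
  have hp : (t.d : ℂ) * (t.point hm τ : ℂ) = t.a * τ + t.b := by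
    simp only [point, UpperHalfPlane.coe_mk]; field_simp
  simp only [Submodule.mem_span_pair, mem_upperLattice, mat, zsmul_eq_mul]
  constructor
  · rintro ⟨k, l, rfl⟩
    exact ⟨_, ⟨k, l, rfl⟩, by simp; linear_combination -k * hp⟩
  · rintro ⟨_, ⟨k, l, rfl⟩, rfl⟩
    exact ⟨k, l, by simp; linear_combination -k * hp⟩

lemma HeckeTriple.matrixJ_eq {m : ℕ} (hm : m ≠ 0) (t : HeckeTriple m) (τ : ℍ) :
    matrixJ t.mat τ = modularJ (t.point hm τ) :=
  latticeJ_smul _ _ (t.d : ℂ) (by exact_mod_cast t.d_pos.ne') (t.mem_span_iff hm τ)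

lemma upperHalfPlane_coeff_unique {τ : ℍ} {k l k' l' : ℤ} (h : (k * τ + l : ℂ) = k' * τ + l') :
    k = k' ∧ l = l' := by
  have e1 := congrArg Complex.im h
  have e2 := congrArg Complex.re h
  simp at e1 e2
  have hk : k = k' := by
    rcases e1 with h | h
    · exact h
    · exact absurd h τ.im_ne_zero
  subst hk
  exact ⟨rfl, by simpa using e2⟩

lemma upperHalfPlane_matrix_unique {τ : ℍ} {M N : Matrix (Fin 2) (Fin 2) ℤ}
    (h0 : (M 0 0 * τ + M 0 1 : ℂ) = N 0 0 * τ + N 0 1)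
    (h1 : (M 1 0 * τ + M 1 1 : ℂ) = N 1 0 * τ + N 1 1) : M = N := by
  obtain ⟨e1, e2⟩ := upperHalfPlane_coeff_unique h0
  obtain ⟨e3, e4⟩ := upperHalfPlane_coeff_unique h1
  rw [Matrix.eta_fin_two M, Matrix.eta_fin_two N, e1, e2, e3, e4]

lemma HeckeTriple.det_mat {m : ℕ} (t : HeckeTriple m) : t.mat.det = m := by
  rw [mat, Matrix.det_fin_two]
  simp only [Matrix.of_apply, Matrix.cons_val', Matrix.cons_val_zero, Matrix.cons_val_one,
    Matrix.cons_val_fin_one, mul_zero, sub_zero]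
  exact_mod_cast t.mul_eq

lemma HeckeTriple.mul_mat_ne_scalar {m : ℕ} (hm : m ≠ 0) (t : HeckeTriple m) (δ : SL(2, ℤ))
    (s : ℤ) : δ.1 * t.mat ≠ !![s, 0; 0, s] := by
  have key : ∀ (δ : SL(2, ℤ)) (s : ℕ), δ.1 * t.mat ≠ !![(s : ℤ), 0; 0, s] := by
    intro δ s h
    have hdet := congrArg Matrix.det h
    rw [Matrix.det_mul, δ.2, t.det_mat, Matrix.det_fin_two] at hdet
    simp at hdet
    have hs : 0 < s := by
      refine Nat.pos_of_ne_zero fun hs => hm ?_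
      rw [hs] at hdet
      exact_mod_cast hdet
    obtain ⟨h1, h2, h3⟩ := hermite_unique (b' := 0) (t.a_pos hm) hs t.b_lt hs δ h
    exact t.not_scalar ⟨h1.trans h3.symm, h2⟩
  intro h
  rcases Int.eq_nat_or_neg s with ⟨n, rfl | rfl⟩
  · exact key δ n h
  -- A negative scalar is reduced to a positive one because -1 lies in SL(2, ℤ).
  · refine key (-δ) n ?_
    rw [Matrix.SpecialLinearGroup.coe_neg, neg_mul, h]
    ext i j; fin_cases i <;> fin_cases j <;> simp

/-- Equal invariants give x with xΛ = Λ', so (xτ, x) and the rows of t (τ, 1) are two bases of Λ'.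
The change of basis B has determinant ±1, and the sign is + because det(B t) = |x|² > 0. -/
lemma exists_basis_change_of_matrixJ_eq {m : ℕ} (hm : m ≠ 0) (t : HeckeTriple m) {τ : ℍ}
    (h : modularJ τ = matrixJ t.mat τ) : ∃ (x : ℂ) (B : SL(2, ℤ)),
      x * τ = (B.1 * t.mat) 0 0 * τ + (B.1 * t.mat) 0 1 ∧
      x = (B.1 * t.mat) 1 0 * τ + (B.1 * t.mat) 1 1 := by
  rw [t.matrixJ_eq hm] at h
  obtain ⟨z, hz, hzm⟩ := exists_homothety_of_modularJ_eq h
  have hd : (t.d : ℂ) ≠ 0 := by exact_mod_cast t.d_pos.ne'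
  set x : ℂ := t.d * z with hx
  have hx0 : x ≠ 0 := mul_ne_zero hd hz
  have hmem : ∀ w : ℂ, w ∈ Submodule.span ℤ {(t.mat 0 0 * τ + t.mat 0 1 : ℂ),
      (t.mat 1 0 * τ + t.mat 1 1 : ℂ)} ↔ ∃ v ∈ upperLattice τ, w = x * v := by
    intro w
    rw [t.mem_span_iff hm]
    constructor
    · rintro ⟨v, hv, rfl⟩
      obtain ⟨v', hv', rfl⟩ := (hzm v).1 hv
      exact ⟨v', hv', by rw [hx]; ring⟩
    · rintro ⟨v', hv', rfl⟩
      exact ⟨z * v', (hzm _).2 ⟨v', hv', rfl⟩, by rw [hx]; ring⟩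
  obtain ⟨p, q, h1⟩ := Submodule.mem_span_pair.1
    ((hmem (x * τ)).2 ⟨τ, mem_upperLattice.2 ⟨1, 0, by simp⟩, rfl⟩)
  obtain ⟨r, s, h2⟩ := Submodule.mem_span_pair.1
    ((hmem x).2 ⟨1, mem_upperLattice.2 ⟨0, 1, by simp⟩, by simp⟩)
  obtain ⟨v, hv, h3⟩ := (hmem _).1 (Submodule.subset_span (Set.mem_insert _ _))
  obtain ⟨w, hw, h4⟩ := (hmem _).1
    (Submodule.subset_span (Set.mem_insert_of_mem _ (Set.mem_singleton _)))
  obtain ⟨p', q', rfl⟩ := mem_upperLattice.1 hv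
  obtain ⟨r', s', rfl⟩ := mem_upperLattice.1 hw
  simp only [zsmul_eq_mul] at h1 h2
  set B : Matrix (Fin 2) (Fin 2) ℤ := !![p, q; r, s] with hB
  have e1 : x * τ = (B * t.mat) 0 0 * τ + (B * t.mat) 0 1 := by
    simp only [Matrix.mul_apply, Fin.sum_univ_two, hB, Matrix.of_apply, Matrix.cons_val',
      Matrix.cons_val_zero, Matrix.cons_val_one, Matrix.cons_val_fin_one]
    push_cast
    linear_combination -h1
  have e2 : x = (B * t.mat) 1 0 * τ + (B * t.mat) 1 1 := by
    simp only [Matrix.mul_apply, Fin.sum_univ_two, hB, Matrix.of_apply, Matrix.cons_val',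
      Matrix.cons_val_zero, Matrix.cons_val_one, Matrix.cons_val_fin_one]
    push_cast
    linear_combination -h2
  have hB' : !![p', q'; r', s'] * (B * t.mat) = t.mat := by
    refine upperHalfPlane_matrix_unique (τ := τ) ?_ ?_
    · rw [h3, Matrix.mul_apply, Matrix.mul_apply]
      simp only [Fin.sum_univ_two, Matrix.of_apply, Matrix.cons_val',
        Matrix.cons_val_zero, Matrix.cons_val_one, Matrix.cons_val_fin_one]
      push_cast
      linear_combination -p' * e1 - q' * e2
    · rw [h4, Matrix.mul_apply, Matrix.mul_apply]
      simp only [Fin.sum_univ_two, Matrix.of_apply, Matrix.cons_val',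
        Matrix.cons_val_zero, Matrix.cons_val_one, Matrix.cons_val_fin_one]
      push_cast
      linear_combination -r' * e1 - s' * e2
  have hdet := congrArg Matrix.det hB'
  have hmz : (m : ℤ) ≠ 0 := by exact_mod_cast hm
  rw [Matrix.det_mul, Matrix.det_mul, t.det_mat, ← mul_assoc, mul_eq_right₀ hmz] at hdet
  have hpos : (0 : ℝ) < (B * t.mat).det := by
    rw [det_eq_normSq e1 e2]; exact Complex.normSq_pos.2 hx0
  rw [Matrix.det_mul, t.det_mat] at hpos
  have hpos' : 0 < B.det := by
    have : 0 < B.det * (m : ℤ) := by exact_mod_cast hpos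
    exact pos_of_mul_pos_left this (by positivity)
  have hB1 : B.det = 1 := by
    rcases Int.eq_one_or_neg_one_of_mul_eq_one' hdet with h | h <;> omega
  exact ⟨x, ⟨B, hB1⟩, e1, e2⟩

/-- The product vanishes iff the multiplier ring of the lattice has a suitable element of
norm `m`. -/
lemma heckeProduct_eq_zero_iff {m : ℕ} (hm : m ≠ 0) (τ : ℍ) :
    heckeProduct m τ = 0 ↔ m ∈ normSet (multipliers (upperLattice τ)) := by
  have := HeckeTriple.finite hm
  have := Fintype.ofFinite (HeckeTriple m)
  rw [heckeProduct, finprod_eq_prod_of_fintype, Finset.prod_eq_zero_iff]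
  constructor
  · rintro ⟨t, -, ht⟩
    obtain ⟨x, B, h1, h2⟩ := exists_basis_change_of_matrixJ_eq hm t (sub_eq_zero.1 ht)
    refine ⟨x, mem_multipliers_upperLattice.2 ⟨_, h1, h2⟩, ?_, ?_⟩
    · rw [← det_eq_normSq h1 h2, Matrix.det_mul, B.2, t.det_mat]
      simp
    · rintro s u hu hu1 rfl
      obtain ⟨N, h3, h4⟩ := mem_multipliers_upperLattice.1 hu
      have hN : N.det = 1 := by
        have := det_eq_normSq h3 h4
        rw [hu1] at this
        exact_mod_cast this
      have hM : B.1 * t.mat = s • N := by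
        refine upperHalfPlane_matrix_unique (τ := τ) ?_ ?_
        · rw [← h1]; simp; linear_combination s * h3
        · rw [← h2]; simp; linear_combination s * h4
      let N' : SL(2, ℤ) := ⟨N, hN⟩
      -- If x = s u and u has matrix N of determinant 1, then N⁻¹ B t is the scalar matrix s, which
      -- the triples exclude.
      refine t.mul_mat_ne_scalar hm (N'⁻¹ * B) s ?_
      have hN' : (N'⁻¹).1 * N = 1 := by
        change (N'⁻¹).1 * N'.1 = 1
        rw [← Matrix.SpecialLinearGroup.coe_mul, inv_mul_cancel, Matrix.SpecialLinearGroup.coe_one]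
      rw [Matrix.SpecialLinearGroup.coe_mul, mul_assoc, hM, mul_smul_comm, hN']
      ext i j; fin_cases i <;> fin_cases j <;> simp
  · rintro ⟨x, hx, hxm, hxs⟩
    obtain ⟨M, h1, h2⟩ := mem_multipliers_upperLattice.1 hx
    have hM : M.det = m := by
      have := det_eq_normSq h1 h2
      rw [hxm] at this
      exact_mod_cast this
    have hx0 : x ≠ 0 := by
      rintro rfl
      simp at hxm
      exact hm (by exact_mod_cast hxm.symm)
    obtain ⟨δ, a, b, d, had, hbd, hδ⟩ := exists_hermite hm M hM
    have hns : ¬ (a = d ∧ b = 0) := by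
      rintro ⟨rfl, rfl⟩
      have ha : (a : ℂ) ≠ 0 := by
        rintro h
        have : a = 0 := by exact_mod_cast h
        exact hm (by rw [← had, this, zero_mul])
      -- A scalar Hermite form would give M = a δ⁻¹, hence x = a u with u a multiplier of norm 1,
      -- against the assumption on x.
      have hMa : M = (a : ℤ) • (δ⁻¹).1 := by
        have h3 : (δ⁻¹).1 * δ.1 = 1 := by
          rw [← Matrix.SpecialLinearGroup.coe_mul, inv_mul_cancel,
            Matrix.SpecialLinearGroup.coe_one]
        have hsc : !![(a : ℤ), (0 : ℕ); 0, a] = (a : ℤ) • (1 : Matrix (Fin 2) (Fin 2) ℤ) := by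
          ext i j; fin_cases i <;> fin_cases j <;> simp
        have := congrArg (fun X => (δ⁻¹).1 * X) hδ
        simp only [hsc, ← mul_assoc, h3, one_mul, mul_smul_comm, mul_one] at this
        exact this
      set N := (δ⁻¹).1 with hN
      set u : ℂ := N 1 0 * τ + N 1 1 with hu
      have hxu : x = a * u := by
        rw [h2, hMa, hu]; simp; ring
      have hut : u * τ = N 0 0 * τ + N 0 1 := by
        refine mul_left_cancel₀ ha ?_
        rw [← mul_assoc, ← hxu, h1, hMa]; simp; ring
      refine hxs a u (mem_multipliers_upperLattice.2 ⟨N, hut, hu⟩) ?_ (by simpa using hxu)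
      rw [← det_eq_normSq hut hu, hN, (δ⁻¹).2]
      simp
    refine ⟨⟨a, b, d, had, hbd, hns⟩, Finset.mem_univ _, sub_eq_zero.2 ?_⟩
    have hmat : HeckeTriple.mat ⟨a, b, d, had, hbd, hns⟩ = δ.1 * M := hδ.symm
    rw [hmat, matrixJ_mul_left]
    refine (latticeJ_smul _ _ x hx0 fun w => ?_).symm
    rw [← h1, ← h2]
    simp only [Submodule.mem_span_pair, zsmul_eq_mul]
    constructor
    · rintro ⟨k, l, rfl⟩
      exact ⟨_, ⟨k, l, rfl⟩, by ring⟩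
    · rintro ⟨_, ⟨k, l, rfl⟩, rfl⟩
      exact ⟨k, l, by ring⟩

/-! ### The modular equation -/

/-- The root of unity `exp (2πi b / d)`. -/
def HeckeTriple.root {m : ℕ} (t : HeckeTriple m) : ℂ :=
  Complex.exp (2 * Real.pi * Complex.I / t.d) ^ t.b

section series

variable {A B : Type*} [CommRing A] [CommRing B]

/-- The expansion of `j(τ) - j((a τ + b) / d)` in powers of `exp (2πiτ/m)`, times the `m²`-th
power of that variable, where `c` is the expansion of `q j` and `ζ = exp (2πi b / d)`. -/
def heckeFactor {m : ℕ} (hm : m ≠ 0) (t : HeckeTriple m) (c : PowerSeries A) (ζ : A) :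
    PowerSeries A :=
  -- In the variable X = exp(2πiτ/m) the two terms are X⁻ᵐ c(Xᵐ) and ζ⁻¹ X^(-a²) c(ζ X^(a²)). The
  -- factor X^(m²) clears both poles since a ≤ m, and ζ⁻¹ is written as ζ^(d-1).
  PowerSeries.X ^ (m ^ 2 - m) * PowerSeries.expand m hm c
    - PowerSeries.C (ζ ^ (t.d - 1)) * (PowerSeries.X ^ (m ^ 2 - t.a ^ 2)
      * PowerSeries.expand (t.a ^ 2) (pow_ne_zero 2 (t.a_pos hm).ne') (PowerSeries.rescale ζ c))

lemma heckeFactor_map {m : ℕ} (hm : m ≠ 0) (t : HeckeTriple m) (c : PowerSeries A) (ζ : A)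
    (f : A →+* B) :
    (heckeFactor hm t c ζ).map f = heckeFactor hm t (c.map f) (f ζ) := by
  simp only [heckeFactor, map_sub, map_mul, map_pow, PowerSeries.map_X, PowerSeries.map_C,
    PowerSeries.map_expand, PowerSeries.rescale_map]

/-- The series of the coefficients whose index is a multiple of `m`. -/
def decimate (m : ℕ) (P : PowerSeries A) : PowerSeries A := PowerSeries.mk fun n => P.coeff (m * n)

lemma decimate_map (m : ℕ) (P : PowerSeries A) (f : A →+* B) :
    (decimate m P).map f = decimate m (P.map f) := by
  ext n; simp [decimate]

end series

lemma hasSum_expand_rescale {P : PowerSeries ℂ} {k : ℕ} (hk : k ≠ 0) {ζ y s : ℂ}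
    (h : HasSum (fun n => P.coeff n * (ζ * y ^ k) ^ n) s) :
    HasSum (fun n => (PowerSeries.expand k hk (PowerSeries.rescale ζ P)).coeff n * y ^ n) s := by
  have hinj : Function.Injective (fun n : ℕ => k * n) := fun a b h =>
    Nat.eq_of_mul_eq_mul_left (Nat.pos_of_ne_zero hk) h
  rw [← hinj.hasSum_iff]
  · convert! h using 2 with n
    simp only [Function.comp_apply, PowerSeries.coeff_expand_mul, PowerSeries.coeff_rescale]
    rw [mul_pow, ← pow_mul]; ring
  · intro n hn
    rw [PowerSeries.coeff_expand_of_not_dvd, zero_mul]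
    rintro ⟨j, rfl⟩
    exact hn ⟨j, rfl⟩

lemma qParam_pow_self {m : ℕ} (hm : m ≠ 0) (τ : ℂ) :
    Periodic.qParam m τ ^ m = Periodic.qParam 1 τ := by
  have : (m : ℂ) ≠ 0 := by exact_mod_cast hm
  rw [Periodic.qParam, Periodic.qParam, ← Complex.exp_nat_mul]
  congr 1
  push_cast
  field_simp

lemma HeckeTriple.qParam_point {m : ℕ} (hm : m ≠ 0) (t : HeckeTriple m) (τ : ℍ) :
    Periodic.qParam 1 (t.point hm τ) = t.root * Periodic.qParam m τ ^ (t.a ^ 2) := by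
  have hd : (t.d : ℂ) ≠ 0 := by exact_mod_cast t.d_pos.ne'
  have ha : (t.a : ℂ) ≠ 0 := by exact_mod_cast (t.a_pos hm).ne'
  have hmd : (m : ℂ) = t.a * t.d := by exact_mod_cast t.mul_eq.symm
  rw [Periodic.qParam, Periodic.qParam, root, ← Complex.exp_nat_mul, ← Complex.exp_nat_mul,
    ← Complex.exp_add]
  congr 1
  simp only [point, UpperHalfPlane.coe_mk]
  push_cast
  rw [hmd]
  field_simp
  ring

lemma HeckeTriple.isPrimitiveRoot {m : ℕ} (t : HeckeTriple m) :
    IsPrimitiveRoot (Complex.exp (2 * Real.pi * Complex.I / t.d)) t.d :=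
  Complex.isPrimitiveRoot_exp _ t.d_pos.ne'

lemma HeckeTriple.root_pow {m : ℕ} (t : HeckeTriple m) : t.root ^ t.d = 1 := by
  rw [root, ← pow_mul, mul_comm t.b, pow_mul, t.isPrimitiveRoot.pow_eq_one, one_pow]

lemma HeckeTriple.root_pow_sub_one_mul {m : ℕ} (t : HeckeTriple m) :
    t.root ^ (t.d - 1) * t.root = 1 := by
  rw [← pow_succ, Nat.sub_add_cancel t.d_pos, t.root_pow]

/-- The expansion of `q j` over `ℂ`. -/
def jSeriesC : PowerSeries ℂ := jSeries.map (Int.castRingHom ℂ)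

lemma hasQExp_heckeFactor {m : ℕ} (hm : m ≠ 0) (t : HeckeTriple m) :
    HasQExp m (heckeFactor hm t jSeriesC t.root)
      (fun τ => Periodic.qParam m τ ^ (m ^ 2) * (modularJ τ - matrixJ t.mat τ)) := by
  have hj := hasQExp_modularJ
  have h1 : HasQExp m (PowerSeries.expand m hm jSeriesC)
      (fun τ => Periodic.qParam m τ ^ m * modularJ τ) := by
    intro τ
    have := hj τ
    rw [Nat.cast_one, ← qParam_pow_self hm, ← one_mul (Periodic.qParam (m : ℝ) (τ : ℂ) ^ m)] at this
    have := hasSum_expand_rescale hm this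
    rw [PowerSeries.rescale_one, RingHom.id_apply] at this
    beta_reduce at this ⊢
    rw [qParam_pow_self hm]
    exact this
  have h2 : HasQExp m (PowerSeries.expand (t.a ^ 2) (pow_ne_zero 2 (t.a_pos hm).ne')
      (PowerSeries.rescale t.root jSeriesC))
      (fun τ => t.root * Periodic.qParam m τ ^ (t.a ^ 2) * matrixJ t.mat τ) := by
    intro τ
    have := hj (t.point hm τ)
    beta_reduce at this
    rw [Nat.cast_one, ← t.matrixJ_eq hm, t.qParam_point hm] at this
    exact hasSum_expand_rescale _ this
  have h3 := ((HasQExp.X_pow m (m ^ 2 - m)).mul h1).sub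
    ((HasQExp.const m (t.root ^ (t.d - 1))).mul ((HasQExp.X_pow m (m ^ 2 - t.a ^ 2)).mul h2))
  convert! h3 using 1
  ext τ
  simp only [Pi.sub_apply, Pi.mul_apply]
  have e1 : m ^ 2 = (m ^ 2 - m) + m := (Nat.sub_add_cancel (Nat.le_self_pow two_ne_zero m)).symm
  have e2 : m ^ 2 = (m ^ 2 - t.a ^ 2) + t.a ^ 2 :=
    (Nat.sub_add_cancel (Nat.pow_le_pow_left (t.a_le hm) 2)).symm
  have e1' := congrArg (fun k => Periodic.qParam m (τ : ℂ) ^ k) e1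
  have e2' := congrArg (fun k => Periodic.qParam m (τ : ℂ) ^ k) e2
  simp only [pow_add] at e1' e2'
  linear_combination modularJ τ * e1' - matrixJ t.mat τ * e2' +
    matrixJ t.mat τ * Periodic.qParam m (τ : ℂ) ^ (m ^ 2 - t.a ^ 2) *
     Periodic.qParam m (τ : ℂ) ^ (t.a ^ 2) * t.root_pow_sub_one_mul

/-- The shift τ ↦ τ + 1 multiplies the variable by a primitive m-th root of unity ω. By uniqueness
of the expansion the n-th coefficient is unchanged when multiplied by ωⁿ. -/
lemma HasQExp.coeff_eq_zero_of_periodic {m : ℕ} (hm : m ≠ 0) {P : PowerSeries ℂ} {f : ℍ → ℂ}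
    (hf : HasQExp m P f) (hper : ∀ τ : ℍ, f ((1 : ℝ) +ᵥ τ) = f τ) {n : ℕ} (hn : ¬ m ∣ n) :
    P.coeff n = 0 := by
  have hmC : (m : ℂ) ≠ 0 := by exact_mod_cast hm
  set ω : ℂ := Complex.exp (2 * Real.pi * Complex.I / m) with hω
  have h1 : HasQExp m (PowerSeries.rescale ω P) f := by
    intro τ
    have := hf ((1 : ℝ) +ᵥ τ)
    rw [hper] at this
    convert! this using 2 with k
    have : Periodic.qParam m (((1 : ℝ) +ᵥ τ : ℍ) : ℂ) = ω * Periodic.qParam m τ := by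
      rw [Periodic.qParam, Periodic.qParam, hω, ← Complex.exp_add]
      congr 1
      simp
      field_simp
    rw [this, PowerSeries.coeff_rescale]
    ring
  have h2 := congrArg (PowerSeries.coeff n) (h1.unique (Nat.pos_of_ne_zero hm) hf)
  rw [PowerSeries.coeff_rescale] at h2
  by_contra h0
  have h3 : ω ^ n = 1 := mul_right_cancel₀ h0 (by rw [h2, one_mul])
  exact hn ((Complex.isPrimitiveRoot_exp m hm).dvd_of_pow_eq_one n h3)

lemma HasQExp.decimate {m : ℕ} (hm : m ≠ 0) {P : PowerSeries ℂ} {f : ℍ → ℂ}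
    (hf : HasQExp m P f) (hper : ∀ τ : ℍ, f ((1 : ℝ) +ᵥ τ) = f τ) :
    HasQExp 1 (_root_.decimate m P) f := by
  intro τ
  have hinj : Function.Injective (fun n : ℕ => m * n) := fun a b h =>
    Nat.eq_of_mul_eq_mul_left (Nat.pos_of_ne_zero hm) h
  have := hf τ
  rw [← hinj.hasSum_iff] at this
  · convert! this using 2 with n
    simp only [_root_.decimate, Function.comp_apply, PowerSeries.coeff_mk, pow_mul]
    rw [qParam_pow_self hm, Nat.cast_one]
  · intro n hn
    rw [hf.coeff_eq_zero_of_periodic hm hper, zero_mul]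
    rintro ⟨j, rfl⟩
    exact hn ⟨j, rfl⟩

/-- The expansion of `heckeProduct m` in powers of `exp (2πiτ/m)`, up to a power of the
variable. -/
def heckeSeries {m : ℕ} (hm : m ≠ 0) : PowerSeries ℂ :=
  ∏ᶠ t : HeckeTriple m, heckeFactor hm t jSeriesC t.root

/-- The polynomial `f` with `heckeProduct m = f(j)`. -/
def modularPoly {m : ℕ} (hm : m ≠ 0) : ℂ[X] :=
  -- Each factor was multiplied by exp(2πiτ/m)^(m²) = qᵐ, so the whole product was multiplied by q
  -- to the power m times the number of triples.
  jPoly (m * Nat.card (HeckeTriple m)) (decimate m (heckeSeries hm))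

lemma hasQExp_heckeSeries {m : ℕ} (hm : m ≠ 0) :
    HasQExp m (heckeSeries hm)
      (fun τ => Periodic.qParam 1 τ ^ (m * Nat.card (HeckeTriple m)) * heckeProduct m τ) := by
  have := HeckeTriple.finite hm
  have := Fintype.ofFinite (HeckeTriple m)
  rw [heckeSeries, finprod_eq_prod_of_fintype]
  convert! HasQExp.prod (s := Finset.univ) fun t _ => hasQExp_heckeFactor hm t using 1
  ext τ
  rw [heckeProduct, finprod_eq_prod_of_fintype, Finset.prod_apply, Finset.prod_mul_distrib, Finset.prod_const,
    ← qParam_pow_self hm, Nat.card_eq_fintype_card, Finset.card_univ, ← pow_mul, ← pow_mul]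
  congr 2
  ring

lemma heckeProduct_qParam_periodic {m : ℕ} (hm : m ≠ 0) (τ : ℍ) :
    Periodic.qParam 1 (((1 : ℝ) +ᵥ τ : ℍ) : ℂ) ^ (m * Nat.card (HeckeTriple m)) *
      heckeProduct m ((1 : ℝ) +ᵥ τ) =
    Periodic.qParam 1 τ ^ (m * Nat.card (HeckeTriple m)) * heckeProduct m τ := by
  have h1 : (1 : ℝ) +ᵥ τ = ModularGroup.T • τ := (UpperHalfPlane.modular_T_smul τ).symm
  have h2 : Periodic.qParam 1 (((1 : ℝ) +ᵥ τ : ℍ) : ℂ) = Periodic.qParam 1 τ := by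
    rw [Periodic.qParam, Periodic.qParam, Complex.exp_eq_exp_iff_exists_int]
    exact ⟨1, by simp; ring⟩
  rw [h2, h1, heckeProduct_smul hm]

lemma heckeProduct_eq_eval {m : ℕ} (hm : m ≠ 0) (τ : ℍ) :
    heckeProduct m τ = (modularPoly hm).eval (modularJ τ) :=
  eq_eval_jPoly ((hasQExp_heckeSeries hm).decimate hm (heckeProduct_qParam_periodic hm))
    (heckeProduct_smul hm) τ

/-! ### Conjugation and integrality of the modular polynomial -/

lemma jSeriesC_map (σ : ℂ →+* ℂ) : jSeriesC.map σ = jSeriesC := by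
  ext n
  simp [jSeriesC, PowerSeries.coeff_map]

/-- For fixed a and d, σ maps d-th roots of unity to d-th roots of unity. It respects the exclusion
of scalar matrices, because these have root 1, which only 1 is mapped to. -/
lemma HeckeTriple.exists_root_eq {m : ℕ} (σ : ℂ →+* ℂ) (t : HeckeTriple m) :
    ∃ t' : HeckeTriple m, t'.a = t.a ∧ t'.d = t.d ∧ t'.root = σ t.root := by
  have : NeZero t.d := ⟨t.d_pos.ne'⟩
  obtain ⟨i, hi, h⟩ := t.isPrimitiveRoot.eq_pow_of_pow_eq_one
    (ξ := σ t.root) (by rw [← map_pow, t.root_pow, map_one])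
  refine ⟨⟨t.a, i, t.d, t.mul_eq, hi, ?_⟩, rfl, rfl, h⟩
  rintro ⟨h1, rfl⟩
  refine t.not_scalar ⟨h1, ?_⟩
  rw [pow_zero, ← map_one σ] at h
  refine t.isPrimitiveRoot.pow_inj t.b_lt t.d_pos ?_
  rw [pow_zero]
  exact (σ.injective h).symm

lemma HeckeTriple.ext_root {m : ℕ} {t t' : HeckeTriple m} (ha : t.a = t'.a) (hd : t.d = t'.d)
    (hr : t.root = t'.root) : t = t' := by
  refine HeckeTriple.ext ha (t.isPrimitiveRoot.pow_inj t.b_lt (hd ▸ t'.b_lt) ?_) hd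
  rw [root, root, ← hd] at hr
  exact hr

lemma heckeFactor_congr {A : Type*} [CommRing A] {m : ℕ} (hm : m ≠ 0) {t t' : HeckeTriple m}
    (ha : t.a = t'.a) (hd : t.d = t'.d) (c : PowerSeries A) (ζ : A) :
    heckeFactor hm t c ζ = heckeFactor hm t' c ζ := by
  obtain ⟨a, b, d, h1, h2, h3⟩ := t
  obtain ⟨a', b', d', h1', h2', h3'⟩ := t'
  simp only at ha hd
  subst ha hd
  rfl

lemma heckeSeries_map {m : ℕ} (hm : m ≠ 0) (σ : ℂ →+* ℂ) :
    (heckeSeries hm).map σ = heckeSeries hm := by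
  have := HeckeTriple.finite hm
  choose e ha hd hr using HeckeTriple.exists_root_eq (m := m) σ
  have hinj : Function.Injective e := fun t t' h =>
    HeckeTriple.ext_root (by rw [← ha, h, ha]) (by rw [← hd, h, hd])
      (σ.injective (by rw [← hr, h, hr]))
  rw [heckeSeries]
  refine (MonoidHom.map_finprod (PowerSeries.map σ : PowerSeries ℂ →* PowerSeries ℂ)
    (Set.toFinite _)).trans ?_
  refine finprod_eq_of_bijective e (Finite.injective_iff_bijective.1 hinj) fun t => ?_
  change (heckeFactor hm t jSeriesC t.root).map σ = _
  rw [heckeFactor_map, jSeriesC_map, hr, heckeFactor_congr hm (ha t) (hd t)]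

lemma modularPoly_map {m : ℕ} (hm : m ≠ 0) (σ : ℂ →+* ℂ) :
    (modularPoly hm).map σ = modularPoly hm := by
  rw [modularPoly, jPoly_map, decimate_map, heckeSeries_map]

/-- Since m is not a square, a² ≠ m and the two terms begin in different degrees. The lowest
coefficient is 1 if a² < m and -ζ^(d-1) if a² > m; it cannot cancel. -/
lemma exists_heckeFactor_eq {A : Type*} [CommRing A] {m : ℕ} (hm : m ≠ 0) (hsq : ¬ IsSquare m)
    (t : HeckeTriple m) {c : PowerSeries A} (hc : c.coeff 0 = 1) {ζ : A} (hζ : IsUnit ζ) :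
    ∃ e ≤ m ^ 2, ∃ U : PowerSeries A, IsUnit (U.coeff 0) ∧
      heckeFactor hm t c ζ = PowerSeries.X ^ e * U := by
  have hne : t.a ^ 2 ≠ m := fun h => hsq ⟨t.a, h.symm.trans (sq _)⟩
  have h1 : m ≤ m ^ 2 := Nat.le_self_pow two_ne_zero m
  have h2 : t.a ^ 2 ≤ m ^ 2 := Nat.pow_le_pow_left (t.a_le hm) 2
  have hc' : PowerSeries.constantCoeff c = 1 := by simpa using hc
  rcases lt_or_gt_of_ne hne with h | h
  · refine ⟨m ^ 2 - m, Nat.sub_le _ _, PowerSeries.expand m hm c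
      - PowerSeries.C (ζ ^ (t.d - 1)) * (PowerSeries.X ^ (m - t.a ^ 2)
      * PowerSeries.expand (t.a ^ 2) (pow_ne_zero 2 (t.a_pos hm).ne')
        (PowerSeries.rescale ζ c)), ?_, ?_⟩
    · have h3 : m - t.a ^ 2 ≠ 0 := by omega
      simp [h3, hc']
    · have h3 : m ^ 2 - t.a ^ 2 = (m ^ 2 - m) + (m - t.a ^ 2) := by omega
      rw [heckeFactor, h3, pow_add]; ring
  · refine ⟨m ^ 2 - t.a ^ 2, Nat.sub_le _ _, PowerSeries.X ^ (t.a ^ 2 - m) *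
      PowerSeries.expand m hm c - PowerSeries.C (ζ ^ (t.d - 1)) *
        PowerSeries.expand (t.a ^ 2) (pow_ne_zero 2 (t.a_pos hm).ne')
        (PowerSeries.rescale ζ c), ?_, ?_⟩
    · have h3 : t.a ^ 2 - m ≠ 0 := by omega
      have h4 : PowerSeries.constantCoeff (PowerSeries.rescale ζ c) = 1 := by
        rw [← PowerSeries.coeff_zero_eq_constantCoeff_apply, PowerSeries.coeff_rescale]
        simp [hc']
      simp [h3, h4, hζ.pow]
    · have h3 : m ^ 2 - m = (m ^ 2 - t.a ^ 2) + (t.a ^ 2 - m) := by omega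
      rw [heckeFactor, h3, pow_add]; ring

lemma exists_prod_eq_X_pow_mul {A ι : Type*} [CommRing A] (N : ℕ) (s : Finset ι)
    (P : ι → PowerSeries A)
    (h : ∀ i ∈ s, ∃ e ≤ N, ∃ U : PowerSeries A, IsUnit (U.coeff 0) ∧ P i = PowerSeries.X ^ e * U) :
    ∃ e ≤ N * s.card, ∃ U : PowerSeries A, IsUnit (U.coeff 0) ∧
      ∏ i ∈ s, P i = PowerSeries.X ^ e * U := by
  classical
  induction s using Finset.induction_on with
  | empty => exact ⟨0, le_rfl, 1, by simp, by simp⟩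
  | insert i s hi ih =>
    obtain ⟨e, he, U, hU, h1⟩ := ih fun j hj => h j (Finset.mem_insert_of_mem hj)
    obtain ⟨e', he', U', hU', h2⟩ := h i (Finset.mem_insert_self _ _)
    refine ⟨e' + e, ?_, U' * U, ?_, ?_⟩
    · rw [Finset.card_insert_of_notMem hi, mul_add, mul_one]; omega
    · simpa using hU'.mul hU
    · rw [Finset.prod_insert hi, h1, h2, pow_add]; ring

lemma decimate_X_pow_mul {A : Type*} [CommRing A] {m : ℕ} (hm : m ≠ 0) (e : ℕ)
    (U : PowerSeries A) :
    decimate m (PowerSeries.X ^ (m * e) * U) = PowerSeries.X ^ e * decimate m U := by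
  ext n
  simp only [decimate, PowerSeries.coeff_mk, PowerSeries.coeff_X_pow_mul', Nat.mul_sub,
    Nat.mul_le_mul_left_iff (Nat.pos_of_ne_zero hm)]

lemma isIntegral_of_isRoot {A : Subalgebra ℤ ℂ} (hA : A = integralClosure ℤ ℂ) {f : A[X]}
    (hf : IsUnit f.leadingCoeff) {x : ℂ} (hx : (f.map (algebraMap A ℂ)).IsRoot x) :
    IsIntegral ℤ x := by
  subst hA
  have h1 : IsIntegral (integralClosure ℤ ℂ) x := by
    obtain ⟨u, hu⟩ := hf
    refine ⟨Polynomial.C (↑u⁻¹ : integralClosure ℤ ℂ) * f, ?_, ?_⟩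
    · rw [Polynomial.Monic, Polynomial.leadingCoeff_mul, Polynomial.leadingCoeff_C, ← hu,
        Units.inv_mul]
    · rw [Polynomial.eval₂_mul, ← Polynomial.eval_map, ← Polynomial.eval_map, hx.eq_zero, mul_zero]
  exact isIntegral_trans x h1

/-- The product is formed over the ring of algebraic integers. Its lowest coefficient is a unit, and
the lowest coefficient of the expansion is the leading coefficient of the polynomial in j. -/
lemma modularPoly_ne_zero_and_isIntegral {m : ℕ} (hm : m ≠ 0) (hsq : ¬ IsSquare m) :
    modularPoly hm ≠ 0 ∧ ∀ x, (modularPoly hm).IsRoot x → IsIntegral ℤ x := by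
  have := HeckeTriple.finite hm
  have := Fintype.ofFinite (HeckeTriple m)
  set A := integralClosure ℤ ℂ with hA
  have hint : ∀ t : HeckeTriple m, t.root ∈ A := fun t =>
    IsIntegral.of_pow t.d_pos (by rw [t.root_pow]; exact isIntegral_one)
  let ζ : HeckeTriple m → A := fun t => ⟨t.root, hint t⟩
  have hζ : ∀ t, IsUnit (ζ t) := fun t => by
    refine IsUnit.of_pow_eq_one (n := t.d) ?_ t.d_pos.ne'
    exact Subtype.ext t.root_pow
  set c : PowerSeries A := jSeries.map (Int.castRingHom A) with hc
  have hc0 : c.coeff 0 = 1 := by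
    rw [hc, PowerSeries.coeff_map, jSeries_coeff_zero, map_one]
  have hcC : c.map (algebraMap A ℂ) = jSeriesC := by
    ext n; simp [hc, jSeriesC, PowerSeries.coeff_map]
  set P : PowerSeries A := ∏ t : HeckeTriple m, heckeFactor hm t c (ζ t) with hP
  have hPC : P.map (algebraMap A ℂ) = heckeSeries hm := by
    rw [heckeSeries, finprod_eq_prod_of_fintype, hP, map_prod]
    refine Finset.prod_congr rfl fun t _ => ?_
    rw [heckeFactor_map, hcC]
    rfl
  obtain ⟨E, hE, U, hU, hPU⟩ := exists_prod_eq_X_pow_mul (m ^ 2) Finset.univ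
    (fun t => heckeFactor hm t c (ζ t))
    fun t _ => exists_heckeFactor_eq hm hsq t hc0 (hζ t)
  rw [← hP] at hPU
  have hU0 : algebraMap A ℂ (U.coeff 0) ≠ 0 := (hU.map _).ne_zero
  have hcoeff : (heckeSeries hm).coeff E ≠ 0 := by
    rw [← hPC, PowerSeries.coeff_map, hPU, PowerSeries.coeff_X_pow_mul', if_pos le_rfl, Nat.sub_self]
    exact hU0
  -- The exponent E carries a nonzero coefficient, and by periodicity only multiples of m do.
  have hdvd : m ∣ E := by
    by_contra h
    exact hcoeff ((hasQExp_heckeSeries hm).coeff_eq_zero_of_periodic hm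
      (heckeProduct_qParam_periodic hm) h)
  obtain ⟨e, rfl⟩ := hdvd
  set N := m * Nat.card (HeckeTriple m) with hN
  have heN : e ≤ N := by
    refine Nat.le_of_mul_le_mul_left (hE.trans_eq ?_) (Nat.pos_of_ne_zero hm)
    rw [hN, Nat.card_eq_fintype_card, Finset.card_univ]; ring
  -- The common factor q^e lowers the pole order from N to N - e, so that the unit U₀ becomes the
  -- coefficient in top degree.
  set f : A[X] := jPoly (N - e) (decimate m U) with hf
  have hfm : f.map (algebraMap A ℂ) = modularPoly hm := by
    rw [modularPoly, ← hPC, ← decimate_map, ← jPoly_map, hPU, decimate_X_pow_mul hm, ← hN]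
    conv_rhs => rw [← Nat.sub_add_cancel heN, jPoly_X_pow_mul]
  have hfc : f.coeff (N - e) = U.coeff 0 := by
    rw [hf, coeff_jPoly]; simp [decimate]
  have hfd : f.natDegree = N - e := by
    refine le_antisymm (natDegree_jPoly_le _ _) (Polynomial.le_natDegree_of_ne_zero ?_)
    rw [hfc]
    rintro h
    exact hU0 (by rw [h, map_zero])
  have hfl : IsUnit f.leadingCoeff := by
    rw [Polynomial.leadingCoeff, hfd, hfc]; exact hU
  refine ⟨?_, fun x hx => isIntegral_of_isRoot rfl hfl (hfm ▸ hx)⟩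
  intro h0
  have := congrArg (fun p => Polynomial.coeff p (N - e)) (hfm.trans h0)
  simp only [Polynomial.coeff_map, hfc, Polynomial.coeff_zero] at this
  exact hU0 this

/-- The polynomial `f` of which the values `j(τ)`, for the lattices with a suitable multiplier of
norm `m`, are the roots. -/
lemma modularPoly_isRoot_iff {m : ℕ} (hm : m ≠ 0) (τ : ℍ) :
    (modularPoly hm).IsRoot (modularJ τ) ↔ m ∈ normSet (multipliers (upperLattice τ)) := by
  rw [← heckeProduct_eq_zero_iff hm, heckeProduct_eq_eval hm, Polynomial.IsRoot.def]

/-- The polynomial F_m is fixed by σ, so j(τ) is a root if and only if σ(j(τ)) is. -/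
lemma normSet_eq_of_modularJ_eq_map (σ : ℂ →+* ℂ) {τ τ' : ℍ} (h : modularJ τ' = σ (modularJ τ))
    {m : ℕ} (hm : m ≠ 0) : m ∈ normSet (multipliers (upperLattice τ')) ↔
      m ∈ normSet (multipliers (upperLattice τ)) := by
  rw [← modularPoly_isRoot_iff hm, ← modularPoly_isRoot_iff hm, h]
  nth_rw 1 [← modularPoly_map hm σ]
  rw [Polynomial.IsRoot.def, Polynomial.eval_map_apply, map_eq_zero, Polynomial.IsRoot.def]

/-! ### Imaginary quadratic orders -/

/-- The order of discriminant `-d` in `ℂ`. -/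
def quadOrder (d : ℕ) : Set ℂ :=
  {x | ∃ t u : ℤ, 2 ∣ t - u * d ∧ 2 * x.re = t ∧ 2 * x.im = u * √(d : ℝ)}

lemma exists_primitive_multiple (a b c : ℤ) (ha : a ≠ 0) : ∃ g A B C : ℤ, g ≠ 0 ∧ 0 < A ∧
    a = g * A ∧ b = g * B ∧ c = g * C ∧ ∃ p q r : ℤ, p * A + q * B + r * C = 1 := by
  have key : ∃ g A B C : ℤ, g ≠ 0 ∧
    a = g * A ∧ b = g * B ∧ c = g * C ∧ ∃ p q r : ℤ, p * A + q * B + r * C = 1 := by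
    set k : ℤ := (Int.gcd a b : ℤ) with hk
    have h1 := Int.gcd_eq_gcd_ab a b
    have h2 := Int.gcd_eq_gcd_ab k c
    set g : ℤ := (Int.gcd k c : ℤ) with hg
    have hgk : g ∣ k := Int.gcd_dvd_left k c
    have hgc : g ∣ c := Int.gcd_dvd_right k c
    have hka : k ∣ a := Int.gcd_dvd_left a b
    have hkb : k ∣ b := Int.gcd_dvd_right a b
    have hg0 : g ≠ 0 := by
      rintro h
      rw [h] at hgk
      exact ha (zero_dvd_iff.1 (hgk.trans hka))
    obtain ⟨A, hA⟩ := hgk.trans hka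
    obtain ⟨B, hB⟩ := hgk.trans hkb
    obtain ⟨C, hC⟩ := hgc
    refine ⟨g, A, B, C, hg0, hA, hB, hC, Int.gcdA a b * Int.gcdA k c, Int.gcdB a b * Int.gcdA k c,
      Int.gcdB k c, mul_left_cancel₀ hg0 ?_⟩
    rw [← hk] at h1
    linear_combination -h2 - Int.gcdA k c * h1 - Int.gcdA a b * Int.gcdA k c * hA
      - Int.gcdB a b * Int.gcdA k c * hB - Int.gcdB k c * hC
  obtain ⟨g, A, B, C, hg, h1, h2, h3, p, q, r, h4⟩ := key
  have hA : A ≠ 0 := by rintro rfl; exact ha (by rw [h1, mul_zero])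
  rcases lt_or_gt_of_ne hA with h | h
  · exact ⟨-g, -A, -B, -C, neg_ne_zero.2 hg, by omega, by rw [h1]; ring, by rw [h2]; ring,
      by rw [h3]; ring, -p, -q, -r, by linear_combination h4⟩
  · exact ⟨g, A, B, C, hg, h, h1, h2, h3, p, q, r, h4⟩

/-- `τ` is a root of the primitive form `[A, B, C]`. -/
structure IsPrimitiveForm (τ : ℍ) (A B C : ℤ) : Prop where
  pos : 0 < A
  eq_zero : (A * τ ^ 2 + B * τ + C : ℂ) = 0
  primitive : ∃ p q r : ℤ, p * A + q * B + r * C = 1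

/-- Eliminating x from xτ = M₀₀τ + M₀₁ and x = M₁₀τ + M₁₁ gives M₁₀τ² + (M₁₁ - M₀₀)τ - M₀₁ = 0, with
M₁₀ ≠ 0 as x is not real. Dividing by the content gives the form. -/
lemma exists_isPrimitiveForm {τ : ℍ} {x : ℂ} (hx : x ∈ multipliers (upperLattice τ))
    (him : x.im ≠ 0) : ∃ A B C : ℤ, IsPrimitiveForm τ A B C := by
  obtain ⟨M, h1, h2⟩ := mem_multipliers_upperLattice.1 hx
  have hc : M 1 0 ≠ 0 := by
    rintro h
    rw [h2, h] at him
    simp at him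
  obtain ⟨g, A, B, C, hg, hA, h3, h4, h5, h6⟩ :=
    exists_primitive_multiple (M 1 0) (M 1 1 - M 0 0) (-M 0 1) hc
  refine ⟨A, B, C, hA, ?_, h6⟩
  have hg' : (g : ℂ) ≠ 0 := by exact_mod_cast hg
  refine mul_left_cancel₀ hg' ?_
  have h3' : (M 1 0 : ℂ) = g * A := by exact_mod_cast h3
  have h4' : (M 1 1 - M 0 0 : ℂ) = g * B := by exact_mod_cast h4
  have h5' : (-M 0 1 : ℂ) = g * C := by exact_mod_cast h5
  linear_combination h1 - τ * h2 - τ ^ 2 * h3' - τ * h4' - h5'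

namespace IsPrimitiveForm

variable {τ : ℍ} {A B C : ℤ}

lemma mem_multipliers_iff (h : IsPrimitiveForm τ A B C) {x : ℂ} :
    x ∈ multipliers (upperLattice τ) ↔ ∃ p q : ℤ, x = p + q * (A * τ) := by
  rw [mem_multipliers_upperLattice]
  constructor
  · rintro ⟨M, h1, h2⟩
    have h3 : ((A * M 0 0 - A * M 1 1 + M 1 0 * B : ℤ) * τ + (A * M 0 1 + M 1 0 * C : ℤ) : ℂ)
        = (0 : ℤ) * τ + (0 : ℤ) := by
      push_cast
      linear_combination -A * h1 + A * τ * h2 + M 1 0 * h.eq_zero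
    obtain ⟨h4, h5⟩ := upperHalfPlane_coeff_unique h3
    obtain ⟨p, q, r, h6⟩ := h.primitive
    -- The vector (M₁₀, M₁₁ - M₀₀, -M₀₁) is proportional to (A, B, C). By primitivity the factor is
    -- the integer pM₁₀ + q(M₁₁ - M₀₀) - rM₀₁.
    have h7 : M 1 0 = A * (p * M 1 0 + q * (M 1 1 - M 0 0) + r * (-M 0 1)) := by
      linear_combination -M 1 0 * h6 + q * h4 + r * h5
    refine ⟨M 1 1, p * M 1 0 + q * (M 1 1 - M 0 0) + r * (-M 0 1), ?_⟩
    have h7' : (M 1 0 : ℂ) = A * (p * M 1 0 + q * (M 1 1 - M 0 0) + r * (-M 0 1)) := by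
      exact_mod_cast h7
    rw [h2]
    push_cast
    linear_combination τ * h7'
  · rintro ⟨p, q, rfl⟩
    refine ⟨!![p - q * B, -q * C; q * A, p], ?_, ?_⟩
    · simp; linear_combination q * h.eq_zero
    · simp; ring

lemma re_eq (h : IsPrimitiveForm τ A B C) : (B : ℝ) = -2 * A * τ.re := by
  have := congrArg Complex.im h.eq_zero
  simp [pow_two] at this
  refine mul_right_cancel₀ τ.im_ne_zero ?_
  linear_combination this

lemma disc_eq (h : IsPrimitiveForm τ A B C) : (4 * A * C - B ^ 2 : ℝ) = (2 * A * τ.im) ^ 2 := by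
  have := congrArg Complex.re h.eq_zero
  simp [pow_two] at this
  rw [h.re_eq] at this ⊢
  linear_combination 4 * A * this

lemma disc_pos (h : IsPrimitiveForm τ A B C) : 0 < 4 * A * C - B ^ 2 := by
  have h1 := h.disc_eq
  have h2 : (0 : ℝ) < A := by exact_mod_cast h.pos
  have h3 : (0 : ℝ) < 4 * A * C - B ^ 2 := by
    rw [h1]
    have := τ.im_pos
    positivity
  exact_mod_cast h3

lemma multipliers_eq (h : IsPrimitiveForm τ A B C) :
    multipliers (upperLattice τ) = quadOrder (4 * A * C - B ^ 2).toNat := by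
  have hA : (0 : ℝ) < A := by exact_mod_cast h.pos
  have hd : (((4 * A * C - B ^ 2).toNat : ℕ) : ℤ) = 4 * A * C - B ^ 2 :=
    Int.toNat_of_nonneg h.disc_pos.le
  have hs : √(((4 * A * C - B ^ 2).toNat : ℕ) : ℝ) = 2 * A * τ.im := by
    have : (((4 * A * C - B ^ 2).toNat : ℕ) : ℝ) = (2 * A * τ.im) ^ 2 := by
      rw [← h.disc_eq]; exact_mod_cast hd
    rw [this, Real.sqrt_sq]
    have := τ.im_pos
    positivity
  ext x
  rw [h.mem_multipliers_iff, quadOrder, Set.mem_ofPred_eq, hs, hd]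
  constructor
  · rintro ⟨p, q, rfl⟩
    refine ⟨2 * p - q * B, q, ?_, ?_, ?_⟩
    -- The parity condition reduces to B² ≡ B mod 2.
    · obtain ⟨k, hk⟩ := Int.even_mul_succ_self (B - 1)
      exact ⟨p - 2 * q * A * C + q * k, by linear_combination q * hk⟩
    · have := h.re_eq
      simp
      linear_combination q * this
    · simp; ring
  · rintro ⟨t, u, ⟨k, hk⟩, h1, h2⟩
    obtain ⟨l, hl⟩ := Int.even_mul_succ_self (B - 1)
    refine ⟨k + 2 * u * A * C - u * l, u, ?_⟩
    have h3 : 2 * (k + 2 * u * A * C - u * l) = t + u * B := by linear_combination -hk + u * hl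
    have h3' : (2 * (k + 2 * u * A * C - u * l) : ℝ) = t + u * B := by exact_mod_cast h3
    have hB := h.re_eq
    apply Complex.ext
    · simp
      linear_combination h1 / 2 - h3' / 2 - u / 2 * hB
    · simp
      linear_combination h2 / 2

lemma disc_mod_four (h : IsPrimitiveForm τ A B C) :
    (4 * A * C - B ^ 2).toNat % 4 = 0 ∨ (4 * A * C - B ^ 2).toNat % 4 = 3 := by
  have hd : (((4 * A * C - B ^ 2).toNat : ℕ) : ℤ) = 4 * (A * C) - B ^ 2 := by
    rw [Int.toNat_of_nonneg h.disc_pos.le]; ring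
  rcases Int.even_or_odd' B with ⟨k, hk | hk⟩
  · have : B ^ 2 = 4 * k ^ 2 := by rw [hk]; ring
    omega
  · have : B ^ 2 = 4 * (k ^ 2 + k) + 1 := by rw [hk]; ring
    omega

end IsPrimitiveForm

/-- A lattice with a multiplier that is not real has an imaginary quadratic order as its ring of
multipliers. -/
lemma exists_multipliers_eq_quadOrder {τ : ℍ} {x : ℂ} (hx : x ∈ multipliers (upperLattice τ))
    (him : x.im ≠ 0) : ∃ d : ℕ, 0 < d ∧ (d % 4 = 0 ∨ d % 4 = 3) ∧
      multipliers (upperLattice τ) = quadOrder d := by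
  obtain ⟨A, B, C, h⟩ := exists_isPrimitiveForm hx him
  refine ⟨_, ?_, h.disc_mod_four, h.multipliers_eq⟩
  have := h.disc_pos
  omega

/-! ### The norms of an imaginary quadratic order determine it -/

lemma mem_normSet_quadOrder {d : ℕ} (hd : 0 < d) {m : ℕ} : m ∈ normSet (quadOrder d) ↔
    ∃ t u : ℤ, 2 ∣ t - u * d ∧ t ^ 2 + u ^ 2 * d = 4 * m ∧
      ∀ s v w : ℤ, 2 ∣ v - w * d → v ^ 2 + w ^ 2 * d = 4 → ¬ (t = s * v ∧ u = s * w) := by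
  have hs : 0 < √(d : ℝ) := Real.sqrt_pos.2 (by exact_mod_cast hd)
  have hs2 : √(d : ℝ) ^ 2 = d := Real.sq_sqrt (by positivity)
  have hnorm : ∀ (x : ℂ) (t u : ℤ), 2 * x.re = t → 2 * x.im = u * √(d : ℝ) →
      4 * Complex.normSq x = ((t ^ 2 + u ^ 2 * d : ℤ) : ℝ) := by
    intro x t u h1 h2
    rw [Complex.normSq_apply]
    push_cast
    rw [← hs2, ← h1]
    linear_combination (2 * x.im + u * √(d : ℝ)) * h2
  constructor
  · rintro ⟨x, ⟨t, u, htu, h1, h2⟩, hm, hx⟩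
    refine ⟨t, u, htu, ?_, ?_⟩
    · have := hnorm x t u h1 h2
      rw [hm] at this
      exact_mod_cast this.symm
    · rintro s v w hvw hv ⟨h3, h4⟩
      have h5 : 2 * (⟨v / 2, w * √(d : ℝ) / 2⟩ : ℂ).re = v := by simp; ring
      have h6 : 2 * (⟨v / 2, w * √(d : ℝ) / 2⟩ : ℂ).im = w * √(d : ℝ) := by simp; ring
      refine hx s ⟨v / 2, w * √(d : ℝ) / 2⟩ ⟨v, w, hvw, h5, h6⟩ ?_ ?_
      · have := hnorm _ v w h5 h6
        rw [hv] at this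
        push_cast at this
        linarith
      · have h3' : (t : ℝ) = s * v := by exact_mod_cast h3
        have h4' : (u : ℝ) = s * w := by exact_mod_cast h4
        apply Complex.ext
        · simp; linear_combination h1 / 2 + h3' / 2
        · simp; linear_combination h2 / 2 + √(d : ℝ) * h4' / 2
  · rintro ⟨t, u, htu, hm, hx⟩
    have h5 : 2 * (⟨t / 2, u * √(d : ℝ) / 2⟩ : ℂ).re = t := by simp; ring
    have h6 : 2 * (⟨t / 2, u * √(d : ℝ) / 2⟩ : ℂ).im = u * √(d : ℝ) := by simp; ring
    refine ⟨⟨t / 2, u * √(d : ℝ) / 2⟩, ⟨t, u, htu, h5, h6⟩, ?_, ?_⟩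
    · have := hnorm _ t u h5 h6
      rw [hm] at this
      push_cast at this
      linarith
    · rintro s y ⟨v, w, hvw, h1, h2⟩ hy hxy
      refine hx s v w hvw ?_ ⟨?_, ?_⟩
      · have := hnorm y v w h1 h2
        rw [hy, mul_one] at this
        exact_mod_cast this.symm
      · have := congrArg Complex.re hxy
        simp at this
        have h3 : (t : ℝ) = s * v := by linear_combination 2 * this + s * h1
        exact_mod_cast h3
      · have := congrArg Complex.im hxy
        simp at this
        have h3 : (u : ℝ) = s * w := by
          refine mul_right_cancel₀ hs.ne' ?_
          linear_combination 2 * this + s * h2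
        exact_mod_cast h3

/-- For d > 4 the only elements of norm 1 are ±1, so the excluded elements are exactly the rational
integers, i.e. those with u = 0. -/
lemma mem_normSet_quadOrder_of_four_lt {d : ℕ} (hd : 4 < d) {m : ℕ} :
    m ∈ normSet (quadOrder d) ↔ ∃ t u : ℤ, u ≠ 0 ∧ 2 ∣ t - u * d ∧ t ^ 2 + u ^ 2 * d = 4 * m := by
  rw [mem_normSet_quadOrder (by omega)]
  constructor
  · rintro ⟨t, u, htu, hm, h⟩
    refine ⟨t, u, ?_, htu, hm⟩
    rintro rfl
    obtain ⟨k, hk⟩ := htu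
    exact h k 2 0 (by simp) (by norm_num) ⟨by linarith, by simp⟩
  · rintro ⟨t, u, hu, htu, hm⟩
    refine ⟨t, u, htu, hm, ?_⟩
    rintro s v w hvw hv ⟨rfl, rfl⟩
    have hw : w ≠ 0 := right_ne_zero_of_mul hu
    have h1 : 1 ≤ w ^ 2 := Order.one_le_iff_pos.2 (sq_pos_iff.2 hw)
    have h2 : (4 : ℤ) < d := by exact_mod_cast hd
    nlinarith [sq_nonneg v]

lemma le_of_mem_normSet_quadOrder {d : ℕ} (hd : 4 < d) {m : ℕ} (h : m ∈ normSet (quadOrder d)) :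
    d ≤ 4 * m := by
  obtain ⟨t, u, hu, -, hm⟩ := (mem_normSet_quadOrder_of_four_lt hd).1 h
  have h1 : 1 ≤ u ^ 2 := Order.one_le_iff_pos.2 (sq_pos_iff.2 hu)
  have : (d : ℤ) ≤ 4 * m := by nlinarith [sq_nonneg t]
  exact_mod_cast this

lemma mem_normSet_quadOrder_of_eq {d : ℕ} (hd : 4 < d) {m : ℕ} (t : ℤ) (ht : 2 ∣ t - d)
    (hm : t ^ 2 + d = 4 * m) : m ∈ normSet (quadOrder d) :=
  (mem_normSet_quadOrder_of_four_lt hd).2 ⟨t, 1, one_ne_zero, by simpa using ht, by simpa using hm⟩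

/-- The least element of the norm set is (d + 1) / 4, rounded down, which leaves only the ambiguity
between 4n - 1 and 4n. The number n + 1 separates these: it is attained for 4n with t = 2, u = 1,
but for 4n - 1 it would require t² = 5. -/
lemma eq_of_normSet_quadOrder_eq_of_four_lt {d d' : ℕ} (hd : 4 < d) (hd' : 4 < d')
    (h4 : d % 4 = 0 ∨ d % 4 = 3) (h4' : d' % 4 = 0 ∨ d' % 4 = 3)
    (h : normSet (quadOrder d) = normSet (quadOrder d')) : d = d' := by
  have hmin : ∀ {e : ℕ}, 4 < e → (e % 4 = 0 ∨ e % 4 = 3) →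
      (e + 1) / 4 ∈ normSet (quadOrder e) := by
    rintro e he (h | h)
    · exact mem_normSet_quadOrder_of_eq he 0 (by omega) (by omega)
    · exact mem_normSet_quadOrder_of_eq he 1 (by omega) (by omega)
  have h1 := le_of_mem_normSet_quadOrder hd (h ▸ hmin hd' h4')
  have h2 := le_of_mem_normSet_quadOrder hd' (h ▸ hmin hd h4)
  have key : ∀ n : ℕ, 4 < 4 * n - 1 →
      normSet (quadOrder (4 * n - 1)) ≠ normSet (quadOrder (4 * n)) := by
    intro n hn he
    have h3 : n + 1 ∈ normSet (quadOrder (4 * n)) :=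
      mem_normSet_quadOrder_of_eq (by omega) 2 (by omega) (by push_cast; ring)
    rw [← he] at h3
    obtain ⟨t, u, hu, -, hm⟩ := (mem_normSet_quadOrder_of_four_lt hn).1 h3
    have hc : ((4 * n - 1 : ℕ) : ℤ) = 4 * n - 1 := by omega
    rw [hc] at hm
    push_cast at hm
    have hn2 : (2 : ℤ) ≤ n := by omega
    have hu1 : 1 ≤ u ^ 2 := Order.one_le_iff_pos.2 (sq_pos_iff.2 hu)
    have hu2 : u ^ 2 < 2 ^ 2 := by nlinarith [sq_nonneg t]
    have hu3 := abs_lt_of_sq_lt_sq hu2 (by norm_num)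
    rw [abs_lt] at hu3
    have hu4 : u ^ 2 = 1 := by
      obtain ⟨h5, h6⟩ := hu3
      interval_cases u <;> simp_all
    rw [hu4] at hm
    have ht : t ^ 2 = 5 := by linarith
    have ht3 : t ^ 2 < 3 ^ 2 := by rw [ht]; norm_num
    have ht4 := abs_lt.1 (abs_lt_of_sq_lt_sq ht3 (by norm_num))
    obtain ⟨h5, h6⟩ := ht4
    interval_cases t <;> omega
  by_contra hne
  rcases lt_or_gt_of_ne hne with hlt | hlt
  · obtain ⟨n, hn⟩ : ∃ n, d' = 4 * n := ⟨d' / 4, by omega⟩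
    have : d = 4 * n - 1 := by omega
    subst hn this
    exact key n hd h
  · obtain ⟨n, hn⟩ : ∃ n, d = 4 * n := ⟨d / 4, by omega⟩
    have : d' = 4 * n - 1 := by omega
    subst hn this
    exact key n hd' h.symm

lemma notMem_normSet_quadOrder_four {m : ℕ} (hm : m = 3 ∨ m = 4) :
    m ∉ normSet (quadOrder 4) := by
  rw [mem_normSet_quadOrder (by norm_num)]
  rintro ⟨t, u, htu, h, hx⟩
  push_cast at htu h hx
  have hu : u ^ 2 < 3 ^ 2 := by
    have : (m : ℤ) ≤ 4 := by omega
    nlinarith [sq_nonneg t]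
  have ht : t ^ 2 < 5 ^ 2 := by
    have : (m : ℤ) ≤ 4 := by omega
    nlinarith [sq_nonneg u]
  obtain ⟨h1, h2⟩ := abs_lt.1 (abs_lt_of_sq_lt_sq hu (by norm_num))
  obtain ⟨h3, h4⟩ := abs_lt.1 (abs_lt_of_sq_lt_sq ht (by norm_num))
  -- For m = 3 there is no solution; for m = 4 every solution is twice an element of norm 1.
  have h5 := hx 2 (t / 2) (u / 2)
  rcases hm with rfl | rfl
  · interval_cases u <;> interval_cases t <;> omega
  · interval_cases u <;> interval_cases t <;> omega

lemma notMem_normSet_quadOrder_three {m : ℕ} (hm : m = 2 ∨ m = 4 ∨ m = 5) :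
    m ∉ normSet (quadOrder 3) := by
  rw [mem_normSet_quadOrder (by norm_num)]
  rintro ⟨t, u, htu, h, hx⟩
  push_cast at htu h hx
  have hu : u ^ 2 < 3 ^ 2 := by
    have : (m : ℤ) ≤ 5 := by omega
    nlinarith [sq_nonneg t]
  have ht : t ^ 2 < 5 ^ 2 := by
    have : (m : ℤ) ≤ 5 := by omega
    nlinarith [sq_nonneg u]
  obtain ⟨h1, h2⟩ := abs_lt.1 (abs_lt_of_sq_lt_sq hu (by norm_num))
  obtain ⟨h3, h4⟩ := abs_lt.1 (abs_lt_of_sq_lt_sq ht (by norm_num))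
  -- Solutions occur only for m = 4, and they are all twice an element of norm 1.
  have h5 := hx 2 (t / 2) (u / 2)
  rcases hm with rfl | rfl | rfl
  · interval_cases u <;> interval_cases t <;> omega
  · interval_cases u <;> interval_cases t <;> omega
  · interval_cases u <;> interval_cases t <;> omega

lemma two_mem_normSet_quadOrder_four : 2 ∈ normSet (quadOrder 4) := by
  rw [mem_normSet_quadOrder (by norm_num)]
  refine ⟨2, 1, by norm_num, by norm_num, ?_⟩
  rintro s v w hvw hv ⟨h1, h2⟩
  rcases Int.eq_one_or_neg_one_of_mul_eq_one h2.symm with rfl | rfl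
  · have : w = 1 := by linarith
    subst this; have : v = 2 := by linarith
    subst this; norm_num at hv
  · have : w = -1 := by linarith
    subst this; have : v = -2 := by linarith
    subst this; norm_num at hv

lemma three_mem_normSet_quadOrder_three : 3 ∈ normSet (quadOrder 3) := by
  rw [mem_normSet_quadOrder (by norm_num)]
  refine ⟨3, 1, by norm_num, by norm_num, ?_⟩
  rintro s v w hvw hv ⟨h1, h2⟩
  rcases Int.eq_one_or_neg_one_of_mul_eq_one h2.symm with rfl | rfl
  · have : w = 1 := by linarith
    subst this; have : v = 3 := by linarith
    subst this; norm_num at hv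
  · have : w = -1 := by linarith
    subst this; have : v = -3 := by linarith
    subst this; norm_num at hv

/-- The norm 2 of 1 + i bounds d by 8. The remaining d = 7 and d = 8 attain 4 and 3, which d = 4
does not. -/
lemma normSet_quadOrder_four_ne {d : ℕ} (hd : 4 < d) (h4 : d % 4 = 0 ∨ d % 4 = 3) :
    normSet (quadOrder 4) ≠ normSet (quadOrder d) := by
  intro h
  have h1 := le_of_mem_normSet_quadOrder hd (h ▸ two_mem_normSet_quadOrder_four)
  have h2 : d = 7 ∨ d = 8 := by omega
  rcases h2 with rfl | rfl
  · exact notMem_normSet_quadOrder_four (Or.inr rfl)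
      (h ▸ mem_normSet_quadOrder_of_eq hd 3 (by norm_num) (by norm_num))
  · exact notMem_normSet_quadOrder_four (Or.inl rfl)
      (h ▸ mem_normSet_quadOrder_of_eq hd 2 (by norm_num) (by norm_num))

/-- The norm 3 bounds d by 12. The remaining d = 4, 7, 8, 11, 12 attain 2, 2, 2, 5, 4, none of which
occurs for d = 3. -/
lemma normSet_quadOrder_three_ne {d : ℕ} (hd : 3 < d) (h4 : d % 4 = 0 ∨ d % 4 = 3) :
    normSet (quadOrder 3) ≠ normSet (quadOrder d) := by
  intro h
  rcases eq_or_ne d 4 with rfl | hd4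
  · exact notMem_normSet_quadOrder_three (Or.inl rfl) (h ▸ two_mem_normSet_quadOrder_four)
  have hd : 4 < d := by omega
  have h1 := le_of_mem_normSet_quadOrder hd (h ▸ three_mem_normSet_quadOrder_three)
  have h2 : d = 7 ∨ d = 8 ∨ d = 11 ∨ d = 12 := by omega
  rcases h2 with rfl | rfl | rfl | rfl
  · exact notMem_normSet_quadOrder_three (Or.inl rfl)
      (h ▸ mem_normSet_quadOrder_of_eq hd 1 (by norm_num) (by norm_num))
  · exact notMem_normSet_quadOrder_three (Or.inl rfl)
      (h ▸ mem_normSet_quadOrder_of_eq hd 0 (by norm_num) (by norm_num))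
  · exact notMem_normSet_quadOrder_three (Or.inr (Or.inr rfl))
      (h ▸ mem_normSet_quadOrder_of_eq hd 3 (by norm_num) (by norm_num))
  · exact notMem_normSet_quadOrder_three (Or.inr (Or.inl rfl))
      (h ▸ mem_normSet_quadOrder_of_eq hd 2 (by norm_num) (by norm_num))

lemma eq_of_normSet_quadOrder_eq {d d' : ℕ} (hd : 0 < d) (hd' : 0 < d')
    (h4 : d % 4 = 0 ∨ d % 4 = 3) (h4' : d' % 4 = 0 ∨ d' % 4 = 3)
    (h : normSet (quadOrder d) = normSet (quadOrder d')) : d = d' := by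
  have h1 : d = 3 ∨ d = 4 ∨ 4 < d := by omega
  have h2 : d' = 3 ∨ d' = 4 ∨ 4 < d' := by omega
  rcases h1 with rfl | rfl | h1 <;> rcases h2 with rfl | rfl | h2
  · rfl
  · exact absurd h (normSet_quadOrder_three_ne (by norm_num) h4')
  · exact absurd h (normSet_quadOrder_three_ne (by omega) h4')
  · exact absurd h.symm (normSet_quadOrder_three_ne (by norm_num) h4)
  · rfl
  · exact absurd h (normSet_quadOrder_four_ne h2 h4')
  · exact absurd h.symm (normSet_quadOrder_three_ne (by omega) h4)
  · exact absurd h.symm (normSet_quadOrder_four_ne h1 h4)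
  · exact eq_of_normSet_quadOrder_eq_of_four_lt h1 h2 h4 h4' h

/-- Take t = d + 2 and u = 1: then 4m = (d + 2)² + d lies strictly between consecutive squares, so m
is not a square. Since u = 1, being s times an element of norm 1 would force s = ±1 and 4m = 4. -/
lemma exists_mem_normSet_quadOrder_not_isSquare {d : ℕ} (hd : 0 < d)
    (h4 : d % 4 = 0 ∨ d % 4 = 3) : ∃ m ∈ normSet (quadOrder d), m ≠ 0 ∧ ¬ IsSquare m := by
  obtain ⟨m, hm⟩ : ∃ m : ℕ, (d + 2) ^ 2 + d = 4 * m := by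
    obtain ⟨k, hk | hk⟩ : ∃ k, d = 4 * k ∨ d = 4 * k + 3 := ⟨d / 4, by omega⟩
    · exact ⟨4 * k ^ 2 + 5 * k + 1, by rw [hk]; ring⟩
    · exact ⟨4 * k ^ 2 + 11 * k + 7, by rw [hk]; ring⟩
  refine ⟨m, ?_, ?_, ?_⟩
  · rw [mem_normSet_quadOrder hd]
    refine ⟨d + 2, 1, ⟨1, by ring⟩, by simpa using (by exact_mod_cast hm), ?_⟩
    rintro s v w hvw hv ⟨h1, h2⟩
    have hs : s ^ 2 = 1 := by
      rcases Int.eq_one_or_neg_one_of_mul_eq_one h2.symm with rfl | rfl <;> norm_num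
    have : ((d : ℤ) + 2) ^ 2 + d = 4 := by
      linear_combination ((d : ℤ) + 2 + s * v) * h1 + d * (1 + s * w) * h2 +
        (v ^ 2 + w ^ 2 * d) * hs + hv
    have hd' : (0 : ℤ) < d := by exact_mod_cast hd
    nlinarith
  · rintro rfl
    nlinarith
  · rintro ⟨r, rfl⟩
    have h1 : d + 2 < 2 * r := by nlinarith
    have h2 : 2 * r < d + 3 := by nlinarith
    omega

/-! ### Ideals of imaginary quadratic orders as lattices -/

lemma multipliers_smul {Λ Λ' : Submodule ℤ ℂ} {z : ℂ} (hz : z ≠ 0)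
    (h : ∀ w, w ∈ Λ' ↔ ∃ v ∈ Λ, w = z * v) : multipliers Λ' = multipliers Λ := by
  ext x
  constructor
  · intro hx v hv
    obtain ⟨v', hv', h1⟩ := (h _).1 (hx (z * v) ((h _).2 ⟨v, hv, rfl⟩))
    rw [mul_left_comm] at h1
    rw [mul_left_cancel₀ hz h1]
    exact hv'
  · intro hx w hw
    obtain ⟨v, hv, rfl⟩ := (h _).1 hw
    exact (h _).2 ⟨x * v, hx v hv, by ring⟩

lemma exists_im_ne_zero_of_isTotallyComplex {K : Type*} [Field K]
    [NumberField.IsTotallyComplex K] (φ : K →+* ℂ) : ∃ x, (φ x).im ≠ 0 := by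
  by_contra! h
  have h1 := NumberField.IsTotallyComplex.isComplex (NumberField.InfinitePlace.mk φ)
  refine NumberField.InfinitePlace.isComplex_mk_iff.1 h1 ?_
  rw [NumberField.ComplexEmbedding.isReal_iff]
  ext x
  rw [NumberField.ComplexEmbedding.conjugate_coe_eq]
  exact Complex.conj_eq_iff_im.2 (h x)

section

variable {K : Type*} [Field K] [NumberField K]

lemma im_eq_zero_of_mem_span (φ : K →+* ℂ) {s : Set K} (h : ∀ x ∈ s, (φ x).im = 0) {x : K}
    (hx : x ∈ Submodule.span ℚ s) : (φ x).im = 0 := by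
  induction hx using Submodule.span_induction with
  | mem x hx => exact h x hx
  | zero => simp
  | add x y _ _ hx hy => simp [hx, hy]
  | smul q x _ hx =>
    rw [Rat.smul_def, map_mul, map_ratCast, Complex.mul_im, hx]
    simp

section

variable {R : Subring K} [IsNumberFieldOrder R]

lemma span_unit_eq_top (I : (FractionalIdeal R⁰ K)ˣ) :
    Submodule.span ℚ ((I : FractionalIdeal R⁰ K) : Set K) = ⊤ := by
  have hI : (I : FractionalIdeal R⁰ K) ≠ 0 := I.ne_zero
  obtain ⟨i, hi, hi0⟩ : ∃ i ∈ (I : FractionalIdeal R⁰ K), i ≠ 0 := by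
    by_contra! h
    exact hI (FractionalIdeal.eq_zero_iff.2 h)
  rw [eq_top_iff]
  intro x _
  have hx : i⁻¹ * x ∈ Submodule.span ℚ (R : Set K) := by
    rw [IsNumberFieldOrder.span_eq_top]; trivial
  have := Submodule.mem_map_of_mem (f := LinearMap.mulLeft ℚ i) hx
  rw [LinearMap.mulLeft_apply, mul_inv_cancel_left₀ hi0, Submodule.map_span] at this
  refine Submodule.span_mono ?_ this
  rintro _ ⟨r, hr, rfl⟩
  have := Submodule.smul_mem ((I : FractionalIdeal R⁰ K) : Submodule R K) ⟨r, hr⟩ hi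
  rw [LinearMap.mulLeft_apply, mul_comm]
  exact this

lemma fg_restrictScalars_unit (I : (FractionalIdeal R⁰ K)ˣ) :
    (((I : FractionalIdeal R⁰ K) : Submodule R K).restrictScalars ℤ).FG := by
  have : Module.Finite ℤ R := IsNumberFieldOrder.finite
  exact (FractionalIdeal.fg_unit I).restrictScalars

/-- The multipliers of an invertible ideal are the elements of the order. -/
lemma multipliers_idealLattice (φ : K →+* ℂ) (I : (FractionalIdeal R⁰ K)ˣ) :
    multipliers (idealLattice φ (I : FractionalIdeal R⁰ K)) = φ '' (R : Set K) := by
  ext x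
  constructor
  · intro hx
    have hI : (I : FractionalIdeal R⁰ K) ≠ 0 := I.ne_zero
    obtain ⟨i, hi, hi0⟩ : ∃ i ∈ (I : FractionalIdeal R⁰ K), i ≠ 0 := by
      by_contra! h
      exact hI (FractionalIdeal.eq_zero_iff.2 h)
    obtain ⟨k, hk, hk'⟩ := (mem_idealLattice φ _ _).1 (hx (φ i) ⟨i, hi, rfl⟩)
    have hxy : x = φ (k / i) := by
      have : φ i ≠ 0 := by simpa using hi0
      rw [map_div₀, hk']
      field_simp
    refine ⟨k / i, ?_, hxy.symm⟩
    have h1 : FractionalIdeal.spanSingleton R⁰ (k / i) * (I : FractionalIdeal R⁰ K) ≤ I := by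
      rw [FractionalIdeal.spanSingleton_mul_le_iff]
      intro z hz
      obtain ⟨w, hw, hw'⟩ := (mem_idealLattice φ _ _).1 (hx (φ z) ⟨z, hz, rfl⟩)
      rw [hxy, ← map_mul] at hw'
      rw [← φ.injective hw']
      exact hw
    -- Here invertibility enters: (k/i) I ⊆ I multiplied by I⁻¹ gives k/i ∈ R.
    have h2 := mul_le_mul_left h1 ((I⁻¹ : (FractionalIdeal R⁰ K)ˣ) : FractionalIdeal R⁰ K)
    rw [mul_assoc, Units.mul_inv, mul_one] at h2
    obtain ⟨r, hr⟩ := (FractionalIdeal.mem_one_iff R⁰).1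
      (h2 (FractionalIdeal.mem_spanSingleton_self R⁰ (k / i)))
    rw [← hr]
    exact r.2
  · rintro ⟨r, hr, rfl⟩ _ ⟨i, hi, rfl⟩
    refine ⟨r * i, ?_, map_mul φ _ _⟩
    exact Submodule.smul_mem ((I : FractionalIdeal R⁰ K) : Submodule R K) ⟨r, hr⟩ hi

end

variable [NumberField.IsTotallyComplex K]

lemma exists_mem_im_ne_zero (φ : K →+* ℂ) {s : Set K} (hs : Submodule.span ℚ s = ⊤) :
    ∃ x ∈ s, (φ x).im ≠ 0 := by
  by_contra! h
  obtain ⟨x, hx⟩ := exists_im_ne_zero_of_isTotallyComplex φ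
  exact hx (im_eq_zero_of_mem_span φ h (hs ▸ Submodule.mem_top))

lemma im_div_ne_zero_of_linearIndependent (hK : Module.finrank ℚ K = 2) (φ : K →+* ℂ) {α β : K}
    (h : LinearIndependent ℚ ![α, β]) : (φ α / φ β).im ≠ 0 := by
  have hβ : β ≠ 0 := h.ne_zero 1
  have hs := h.span_eq_top_of_card_eq_finrank (by simp [hK])
  intro him
  obtain ⟨x, hx⟩ := exists_im_ne_zero_of_isTotallyComplex φ
  have hmem : β * x ∈ Submodule.span ℚ (Set.range ![α, β]) := hs ▸ Submodule.mem_top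
  rw [Matrix.range_cons, Matrix.range_cons, Matrix.range_empty, Set.union_empty,
    Set.singleton_union, Submodule.mem_span_pair] at hmem
  obtain ⟨p, q, hpq⟩ := hmem
  have hβ' : φ β ≠ 0 := by simpa using hβ
  have h1 : φ x = p * (φ α / φ β) + q := by
    have := congrArg φ hpq
    simp only [Rat.smul_def, map_add, map_mul, map_ratCast] at this
    field_simp
    linear_combination -this
  rw [h1] at hx
  simp [him] at hx

lemma exists_upperHalfPlane_basis (hK : Module.finrank ℚ K = 2) (φ : K →+* ℂ)
    (N : Submodule ℤ K) (hfg : N.FG) (hspan : Submodule.span ℚ (N : Set K) = ⊤) :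
    ∃ (α β : K) (ω : ℍ), N = Submodule.span ℤ {α, β} ∧ (ω : ℂ) = φ α / φ β := by
  have : Module.Finite ℤ N := Module.Finite.iff_fg.2 hfg
  have : Module.IsTorsionFree ℤ N := inferInstance
  have : Module.Free ℤ N := inferInstance
  set b := Module.finBasis ℤ N with hb
  have hli : LinearIndependent ℚ (fun i => (b i : K)) := by
    rw [← LinearIndependent.iff_fractionRing ℤ ℚ]
    exact b.linearIndependent.map' N.subtype (Submodule.ker_subtype N)
  have hN : N = Submodule.span ℤ (Set.range fun i => (b i : K)) := by
    have := congrArg (Submodule.map N.subtype) b.span_eq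
    rw [Submodule.map_span, ← Set.range_comp, Submodule.map_top, Submodule.range_subtype] at this
    exact this.symm
  have hspan' : ⊤ ≤ Submodule.span ℚ (Set.range fun i => (b i : K)) := by
    rw [← hspan, Submodule.span_le]
    intro x hx
    rw [SetLike.mem_coe, hN] at hx
    exact Submodule.span_le_restrictScalars ℤ ℚ _ hx
  have hcard : Module.finrank ℤ N = 2 := by
    rw [← hK, Module.finrank_eq_card_basis (Module.Basis.mk hli hspan'), Fintype.card_fin]
  have hgen : ∀ (n : ℕ) (hn : n = 2) (v : Fin n → K), LinearIndependent ℚ v →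
      N = Submodule.span ℤ (Set.range v) →
      ∃ α β : K, N = Submodule.span ℤ {α, β} ∧ LinearIndependent ℚ ![α, β] := by
    rintro n rfl v hv hNv
    have hv' : v = ![v 0, v 1] := by
      ext i; fin_cases i <;> rfl
    refine ⟨v 0, v 1, ?_, hv' ▸ hv⟩
    rw [hNv, hv', Matrix.range_cons, Matrix.range_cons, Matrix.range_empty, Set.union_empty,
      Set.singleton_union]
    rfl
  obtain ⟨α, β, hαβ, hind⟩ := hgen _ hcard _ hli hN
  have him := im_div_ne_zero_of_linearIndependent hK φ hind
  -- The basis is ordered so that the quotient has positive imaginary part.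
  rcases lt_or_gt_of_ne him with h | h
  · refine ⟨β, α, ⟨φ β / φ α, ?_⟩, by rw [hαβ, Set.pair_comm], rfl⟩
    rw [← inv_div, Complex.inv_im]
    refine div_pos (by linarith) (Complex.normSq_pos.2 ?_)
    rintro h0
    rw [h0] at him
    simp at him
  · exact ⟨α, β, ⟨φ α / φ β, h⟩, hαβ, rfl⟩

variable {R : Subring K} [IsNumberFieldOrder R]

lemma exists_upperLattice_of_unit (hK : Module.finrank ℚ K = 2) (φ : K →+* ℂ)
    (I : (FractionalIdeal R⁰ K)ˣ) : ∃ (z : ℂ) (ω : ℍ), z ≠ 0 ∧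
      (∀ w, w ∈ idealLattice φ (I : FractionalIdeal R⁰ K) ↔ ∃ v ∈ upperLattice ω, w = z * v) ∧
      multipliers (upperLattice ω) = φ '' (R : Set K) ∧
      classInvariant φ (ClassGroup.mk K I) = modularJ ω := by
  obtain ⟨α, β, ω, hI, hω⟩ := exists_upperHalfPlane_basis hK φ _ (fg_restrictScalars_unit I)
    (span_unit_eq_top I)
  have h2 : φ β ≠ 0 := fun h => ω.ne_zero (by rw [hω, h, div_zero])
  have h1 : φ α = φ β * ω := by rw [hω]; field_simp
  have hmem : ∀ w, w ∈ idealLattice φ (I : FractionalIdeal R⁰ K) ↔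
      ∃ v ∈ upperLattice ω, w = φ β * v := by
    intro w
    unfold idealLattice
    rw [hI, Submodule.map_span, Set.image_pair]
    simp only [Submodule.mem_span_pair, AddMonoidHom.coe_toIntLinearMap, AddMonoidHom.coe_coe,
      zsmul_eq_mul, mem_upperLattice]
    constructor
    · rintro ⟨a, b, rfl⟩
      exact ⟨_, ⟨a, b, rfl⟩, by rw [h1]; ring⟩
    · rintro ⟨_, ⟨a, b, rfl⟩, rfl⟩
      exact ⟨a, b, by rw [h1]; ring⟩
  refine ⟨φ β, ω, h2, hmem, ?_, classInvariant_mk_of_basis φ I α β hI ω hω⟩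
  rw [← multipliers_smul h2 hmem, multipliers_idealLattice]

lemma exists_image_eq_quadOrder (hK : Module.finrank ℚ K = 2) (φ : K →+* ℂ) (R : Subring K)
    [IsNumberFieldOrder R] : ∃ d : ℕ, 0 < d ∧ (d % 4 = 0 ∨ d % 4 = 3) ∧
      φ '' (R : Set K) = quadOrder d := by
  obtain ⟨z, ω, -, -, h, -⟩ := exists_upperLattice_of_unit hK φ (1 : (FractionalIdeal R⁰ K)ˣ)
  obtain ⟨r, hr, him⟩ := exists_mem_im_ne_zero φ (IsNumberFieldOrder.span_eq_top (R := R))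
  rw [← h]
  exact exists_multipliers_eq_quadOrder (x := φ r) (h ▸ ⟨r, hr, rfl⟩) him

/-- A lattice whose multipliers are the elements of `R` comes from an invertible ideal of `R`. -/
lemma exists_classInvariant_eq (φ : K →+* ℂ) {τ : ℍ}
    (h : multipliers (upperLattice τ) = φ '' (R : Set K)) :
    ∃ c : ClassGroup R, classInvariant φ c = modularJ τ := by
  obtain ⟨r, hr, him⟩ := exists_mem_im_ne_zero φ (IsNumberFieldOrder.span_eq_top (R := R))
  obtain ⟨A, B, C, hf⟩ := exists_isPrimitiveForm (x := φ r) (h.symm ▸ Set.mem_image_of_mem φ hr) him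
  have hAτ : (A * τ : ℂ) ∈ multipliers (upperLattice τ) :=
    hf.mem_multipliers_iff.2 ⟨0, 1, by simp⟩
  rw [h] at hAτ
  obtain ⟨ρ, hρ, hρτ⟩ := hAτ
  have hA0 : (A : K) ≠ 0 := by exact_mod_cast hf.pos.ne'
  have hA0' : (A : ℂ) ≠ 0 := by exact_mod_cast hf.pos.ne'
  obtain ⟨θ, hθρ⟩ : ∃ θ : K, (A : K) * θ = ρ := ⟨ρ / A, by field_simp⟩
  have hθ : φ θ = τ := by
    refine mul_left_cancel₀ hA0' ?_
    rw [← hρτ, ← hθρ, map_mul, map_intCast]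
  have hquad : (A : K) * θ ^ 2 + B * θ + C = 0 := by
    refine φ.injective ?_
    simp only [map_add, map_mul, map_pow, map_intCast, map_zero, hθ]
    exact hf.eq_zero
  obtain ⟨p, q, s, hpqs⟩ := hf.primitive
  have hpqs' : (p * A + q * B + s * C : K) = 1 := by exact_mod_cast hpqs
  have hone : ∀ x ∈ R, FractionalIdeal.spanSingleton R⁰ x ≤ 1 := by
    intro x hx
    rw [FractionalIdeal.spanSingleton_le_iff_mem, FractionalIdeal.mem_one_iff]
    exact ⟨⟨x, hx⟩, rfl⟩
  have hsmul : ∀ (n : ℤ) (x y : K) (J : FractionalIdeal R⁰ K), x ∈ J → y = n * x → y ∈ J := by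
    rintro n x _ J hx rfl
    have := Submodule.smul_mem (J : Submodule R K) (n : R) hx
    rw [Subring.smul_def, smul_eq_mul] at this
    simpa using! this
  set I : FractionalIdeal R⁰ K := FractionalIdeal.spanSingleton R⁰ θ + 1 with hI
  -- J is A times the conjugate of I = Rθ + R, because the conjugate of Aθ is -B - Aθ. The products
  -- of generators are A, Aθ, -B - Aθ and C.
  set J : FractionalIdeal R⁰ K := FractionalIdeal.spanSingleton R⁰ (-B - A * θ) +
    FractionalIdeal.spanSingleton R⁰ (A : K) with hJ
  have hθI : θ ∈ I := (FractionalIdeal.mem_add _ _ _).2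
    ⟨θ, FractionalIdeal.mem_spanSingleton_self _ _, 0, FractionalIdeal.zero_mem _, add_zero _⟩
  have h1I : (1 : K) ∈ I := (FractionalIdeal.mem_add _ _ _).2
    ⟨0, FractionalIdeal.zero_mem _, 1, FractionalIdeal.one_mem_one _, zero_add _⟩
  have hBJ : (-B - A * θ : K) ∈ J := (FractionalIdeal.mem_add _ _ _).2
    ⟨_, FractionalIdeal.mem_spanSingleton_self _ _, 0, FractionalIdeal.zero_mem _, add_zero _⟩
  have hAJ : (A : K) ∈ J := (FractionalIdeal.mem_add _ _ _).2
    ⟨0, FractionalIdeal.zero_mem _, _, FractionalIdeal.mem_spanSingleton_self _ _, zero_add _⟩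
  have hIJ : I * J = 1 := by
    apply le_antisymm
    · rw [hI, hJ, add_mul, mul_add, one_mul, FractionalIdeal.spanSingleton_mul_spanSingleton,
        FractionalIdeal.spanSingleton_mul_spanSingleton]
      have e1 : θ * (-B - A * θ) = C := by linear_combination -hquad
      have e2 : θ * A = ρ := by rw [← hθρ, mul_comm]
      rw [e1, e2, hθρ]
      simp only [← FractionalIdeal.sup_eq_add, sup_le_iff]
      exact ⟨⟨hone _ (intCast_mem R C), hone _ hρ⟩,
        hone _ (R.sub_mem (R.neg_mem (intCast_mem R B)) hρ), hone _ (intCast_mem R A)⟩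
    · rw [FractionalIdeal.one_le]
      -- The combination pA - q(-B - Aθ) - q(Aθ) + sC equals pA + qB + sC = 1.
      have e1 := hsmul p _ _ _ (FractionalIdeal.mul_mem_mul h1I hAJ) rfl
      have e2 := hsmul (-q) _ _ _ (FractionalIdeal.mul_mem_mul h1I hBJ) rfl
      have e3 := hsmul (-q) _ _ _ (FractionalIdeal.mul_mem_mul hθI hAJ) rfl
      have e4 := hsmul s _ _ _ (FractionalIdeal.mul_mem_mul hθI hBJ) rfl
      have e5 := Submodule.add_mem ((I * J : FractionalIdeal R⁰ K) : Submodule R K)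
        (Submodule.add_mem _ e1 e2) (Submodule.add_mem _ e3 e4)
      convert! e5 using 1
      push_cast
      linear_combination -hpqs' + s * hquad
  refine ⟨ClassGroup.mk K (Units.mkOfMulEqOne I J hIJ), ?_⟩
  refine classInvariant_mk_of_basis φ _ θ 1 ?_ τ (by simp [hθ])
  rw [Units.val_mkOfMulEqOne]
  apply le_antisymm
  -- The elements of R multiply ℤτ + ℤ into itself, so Rθ + R is no larger than ℤθ + ℤ.
  · have hR : ∀ x ∈ R, ∀ k l : ℤ, ∃ k' l' : ℤ, x * (k * θ + l) = k' * θ + l' := by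
      intro x hx k l
      have hx' : φ x ∈ multipliers (upperLattice τ) := h ▸ ⟨x, hx, rfl⟩
      obtain ⟨k', l', hk⟩ := mem_upperLattice.1
        (hx' _ (mem_upperLattice.2 ⟨k, l, rfl⟩))
      refine ⟨k', l', φ.injective ?_⟩
      simp only [map_add, map_mul, map_intCast, hθ]
      exact hk
    intro x hx
    obtain ⟨y, hy, w, hw, rfl⟩ := (FractionalIdeal.mem_add _ _ _).1
      (show x ∈ FractionalIdeal.spanSingleton R⁰ θ + 1 from hx)
    obtain ⟨a, rfl⟩ := (FractionalIdeal.mem_spanSingleton R⁰).1 hy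
    obtain ⟨b, rfl⟩ := (FractionalIdeal.mem_one_iff R⁰).1 hw
    obtain ⟨k, l, hkl⟩ := hR a a.2 1 0
    obtain ⟨k', l', hkl'⟩ := hR b b.2 0 1
    rw [Submodule.mem_span_pair]
    refine ⟨k + k', l + l', ?_⟩
    have e1 : a • θ = k * θ + l := by
      rw [← hkl, Subring.smul_def, smul_eq_mul]; simp
    have e2 : algebraMap R K b = k' * θ + l' := by
      rw [← hkl']; simp only [Int.cast_zero, zero_mul, Int.cast_one, zero_add, mul_one]; rfl
    rw [e1, e2]
    simp only [zsmul_eq_mul]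
    push_cast
    ring
  · rw [Submodule.span_le]
    rintro x (hx | hx)
    · rw [hx]; exact hθI
    · rw [Set.mem_singleton_iff.1 hx]; exact h1I

/-- Classes with the same invariant are equal. -/
lemma classInvariant_injective (hK : Module.finrank ℚ K = 2) (φ : K →+* ℂ) :
    Function.Injective (classInvariant (R := R) φ) := by
  intro c c'
  refine ClassGroup.induction K (fun I => ?_) c
  refine ClassGroup.induction K (fun I' => ?_) c'
  intro h
  obtain ⟨z, ω, hz, hm, -, hj⟩ := exists_upperLattice_of_unit hK φ I
  obtain ⟨z', ω', hz', hm', -, hj'⟩ := exists_upperLattice_of_unit hK φ I'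
  rw [hj, hj'] at h
  obtain ⟨y, hy, hyω⟩ := exists_homothety_of_modularJ_eq h
  set x : ℂ := z' * y / z with hx
  have hx0 : x ≠ 0 := div_ne_zero (mul_ne_zero hz' hy) hz
  have hxz : x * z = z' * y := div_mul_cancel₀ _ hz
  have hlat : ∀ w, w ∈ idealLattice φ (I' : FractionalIdeal R⁰ K) ↔
      ∃ v ∈ idealLattice φ (I : FractionalIdeal R⁰ K), w = x * v := by
    intro w
    rw [hm']
    constructor
    · rintro ⟨v, hv, rfl⟩
      obtain ⟨u, hu, rfl⟩ := (hyω v).1 hv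
      exact ⟨z * u, (hm _).2 ⟨u, hu, rfl⟩, by linear_combination -u * hxz⟩
    · rintro ⟨v, hv, rfl⟩
      obtain ⟨u, hu, rfl⟩ := (hm v).1 hv
      exact ⟨y * u, (hyω _).2 ⟨u, hu, rfl⟩, by linear_combination u * hxz⟩
  have hI : (I : FractionalIdeal R⁰ K) ≠ 0 := I.ne_zero
  obtain ⟨i, hi, hi0⟩ : ∃ i ∈ (I : FractionalIdeal R⁰ K), i ≠ 0 := by
    by_contra! h
    exact hI (FractionalIdeal.eq_zero_iff.2 h)
  -- The homothety factor x is a quotient of elements of φ(K), so the homothety comes from a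
  -- principal ideal.
  obtain ⟨k, hk, hk'⟩ := (mem_idealLattice φ _ _).1 ((hlat _).2 ⟨φ i, ⟨i, hi, rfl⟩, rfl⟩)
  have hxk : φ (k / i) = x := by
    have : φ i ≠ 0 := by simpa using hi0
    rw [map_div₀, hk']
    field_simp
  have hki : k / i ≠ 0 := by
    rintro h0
    rw [h0, map_zero] at hxk
    exact hx0 hxk.symm
  have key : I * toPrincipalIdeal R K (Units.mk0 _ hki) = I' := by
    ext1
    rw [Units.val_mul, coe_toPrincipalIdeal, Units.val_mk0, mul_comm]
    ext w
    rw [FractionalIdeal.mem_singleton_mul]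
    constructor
    · rintro ⟨b, hb, rfl⟩
      obtain ⟨a, ha, hab⟩ := (mem_idealLattice φ _ _).1 ((hlat _).2 ⟨φ b, ⟨b, hb, rfl⟩, rfl⟩)
      rw [← hxk, ← map_mul] at hab
      rw [← φ.injective hab]
      exact ha
    · intro hw
      obtain ⟨_, ⟨b, hb, rfl⟩, hwb⟩ := (hlat (φ w)).1 ⟨w, hw, rfl⟩
      refine ⟨b, hb, φ.injective ?_⟩
      rw [hwb, map_mul, hxk]
      rfl
  rw [← key, map_mul, left_eq_mul, ClassGroup.mk_eq_one_iff, coe_toPrincipalIdeal,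
    FractionalIdeal.coe_spanSingleton]
  exact ⟨⟨_, rfl⟩⟩

end

/-! ### Endomorphisms of the field of complex numbers -/

/-- An automorphism of a subfield `F` of `ℂ` extends to an endomorphism of `ℂ`. -/
lemma exists_ringHom_extending {F : Type*} [Field F] [Algebra F ℂ] (σ : F ≃+* F) :
    ∃ σ' : ℂ →+* ℂ, ∀ x : F, σ' (algebraMap F ℂ x) = algebraMap F ℂ (σ x) := by
  -- Over a transcendence basis, σ acts on the coefficients of polynomials; ℂ is an algebraic
  -- closure of this polynomial ring, so the action extends.
  obtain ⟨ι, v, hv⟩ := exists_isTranscendenceBasis' F ℂ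
  have := IsAlgClosed.isAlgClosure_of_transcendence_basis v hv
  set S := Algebra.adjoin F (Set.range v)
  let e := hv.1.aevalEquiv
  let f : S ≃+* S := (e.symm.toRingEquiv.trans (MvPolynomial.mapEquiv ι σ)).trans e.toRingEquiv
  refine ⟨(IsAlgClosure.equivOfEquiv ℂ ℂ f : ℂ ≃+* ℂ), fun x => ?_⟩
  have h1 : f (algebraMap F S x) = algebraMap F S (σ x) := by
    simp only [f, RingEquiv.trans_apply, AlgEquiv.coe_ringEquiv,
      AlgEquiv.commutes, MvPolynomial.algebraMap_eq, MvPolynomial.mapEquiv_apply,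
      MvPolynomial.map_C]
    exact e.commutes (σ x)
  have h2 := IsAlgClosure.equivOfEquiv_algebraMap ℂ ℂ f (algebraMap F S x)
  rw [h1] at h2
  exact h2

/-- An algebraic integer that is fixed by the endomorphisms of `ℂ` is a rational integer. -/
lemma exists_int_of_isIntegral_of_fixed {x : ℂ} (hx : IsIntegral ℤ x)
    (h : ∀ σ : ℂ →+* ℂ, σ x = x) : ∃ n : ℤ, (n : ℂ) = x := by
  have hxQ : IsAlgebraic ℚ x := (hx.tower_top (A := ℚ)).isAlgebraic
  have : IsAlgClosure ℚ (algebraicClosure ℚ ℂ) := algebraicClosure.isAlgClosure ℚ ℂ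
  have : IsGalois ℚ (algebraicClosure ℚ ℂ) := IsAlgClosure.isGalois ℚ _
  let y : algebraicClosure ℚ ℂ := ⟨x, mem_algebraicClosure_iff.2 hxQ⟩
  have hy : y ∈ Set.range (algebraMap ℚ (algebraicClosure ℚ ℂ)) := by
    rw [InfiniteGalois.mem_range_algebraMap_iff_fixed]
    intro f
    -- Each automorphism of the algebraic closure of ℚ in ℂ extends to ℂ, so it fixes x; hence x is
    -- rational.
    obtain ⟨σ, hσ⟩ := exists_ringHom_extending (f : algebraicClosure ℚ ℂ ≃+* algebraicClosure ℚ ℂ)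
    refine Subtype.ext ?_
    exact (hσ y).symm.trans (h σ)
  obtain ⟨q, hq⟩ := hy
  have hqx : algebraMap ℚ ℂ q = x := congrArg Subtype.val hq
  rw [← hqx, isIntegral_algebraMap_iff (algebraMap ℚ ℂ).injective] at hx
  obtain ⟨n, hn⟩ := IsIntegrallyClosed.isIntegral_iff.1 hx
  exact ⟨n, by rw [← hqx, ← hn]; simp⟩

/-! ### Conjugates of lattices and of class invariants -/

lemma exists_multiplier_im_ne_zero {τ : ℍ} {m : ℕ}
    (h : m ∈ normSet (multipliers (upperLattice τ))) :
    ∃ x ∈ multipliers (upperLattice τ), x.im ≠ 0 := by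
  obtain ⟨x, hx, -, hs⟩ := h
  refine ⟨x, hx, fun him => ?_⟩
  obtain ⟨M, -, h2⟩ := mem_multipliers_upperLattice.1 hx
  have h3 : M 1 0 = 0 := by
    rw [h2] at him
    simpa [τ.im_ne_zero] using him
  -- A real multiplier is an integer, hence an integer times the multiplier 1, which the norm set
  -- excludes.
  refine hs (M 1 1) 1 ?_ (by simp) (by rw [h2, h3]; simp)
  intro v hv
  rwa [one_mul]

lemma zero_notMem_normSet_multipliers (Λ : Submodule ℤ ℂ) : 0 ∉ normSet (multipliers Λ) := by
  rintro ⟨x, -, hx0, hs⟩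
  refine hs 0 1 (fun v hv => by rwa [one_mul]) (by simp) ?_
  simpa using hx0

/-- Conjugate lattices have the same multipliers. -/
lemma multipliers_eq_of_modularJ_eq_map (σ : ℂ →+* ℂ) {τ τ' : ℍ} {d : ℕ} (hd : 0 < d)
    (h4 : d % 4 = 0 ∨ d % 4 = 3) (hτ : multipliers (upperLattice τ) = quadOrder d)
    (h : modularJ τ' = σ (modularJ τ)) : multipliers (upperLattice τ') = quadOrder d := by
  have hN : normSet (multipliers (upperLattice τ')) = normSet (multipliers (upperLattice τ)) := by
    ext m
    rcases eq_or_ne m 0 with rfl | hm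
    · exact iff_of_false (zero_notMem_normSet_multipliers _) (zero_notMem_normSet_multipliers _)
    · exact normSet_eq_of_modularJ_eq_map σ h hm
  -- The common norm set is nonempty, so τ' also has a non-real multiplier and its ring is some
  -- imaginary quadratic order.
  obtain ⟨m, hm, -, -⟩ := exists_mem_normSet_quadOrder_not_isSquare hd h4
  rw [← hτ, ← hN] at hm
  obtain ⟨x, hx, him⟩ := exists_multiplier_im_ne_zero hm
  obtain ⟨d', hd', h4', hτ'⟩ := exists_multipliers_eq_quadOrder hx him
  rw [hτ, hτ'] at hN
  rw [hτ', eq_of_normSet_quadOrder_eq hd' hd h4' h4 hN]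

section

variable {K : Type*} [Field K] [NumberField K] [NumberField.IsTotallyComplex K]

/-- Surjectivity of j yields a lattice with invariant σ(j(𝔨)). It has the same multipliers as the
ideals of 𝔨, namely R, so it comes from an invertible ideal. -/
lemma exists_classInvariant_eq_map (hK : Module.finrank ℚ K = 2) (φ : K →+* ℂ) {R : Subring K}
    [IsNumberFieldOrder R] (σ : ℂ →+* ℂ) (c : ClassGroup R) :
    ∃ c' : ClassGroup R, classInvariant φ c' = σ (classInvariant φ c) := by
  refine ClassGroup.induction K (fun I => ?_) c
  obtain ⟨d, hd, h4, hR⟩ := exists_image_eq_quadOrder hK φ R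
  obtain ⟨-, ω, -, -, hω, hj⟩ := exists_upperLattice_of_unit hK φ I
  obtain ⟨τ, hτ⟩ := exists_modularJ_eq (σ (modularJ ω))
  obtain ⟨c', hc'⟩ := exists_classInvariant_eq (R := R) φ (τ := τ)
    ((multipliers_eq_of_modularJ_eq_map σ hd h4 (hω.trans hR) hτ).trans hR.symm)
  exact ⟨c', by rw [hc', hτ, hj]⟩

/-- The class invariants are roots of a polynomial that has only algebraic integers as roots. -/
lemma exists_isRoot_classInvariant (hK : Module.finrank ℚ K = 2) (φ : K →+* ℂ) (R : Subring K)
    [IsNumberFieldOrder R] : ∃ f : ℂ[X], f ≠ 0 ∧ (∀ x, f.IsRoot x → IsIntegral ℤ x) ∧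
      ∀ c : ClassGroup R, f.IsRoot (classInvariant φ c) := by
  obtain ⟨d, hd, h4, hR⟩ := exists_image_eq_quadOrder hK φ R
  obtain ⟨m, hm, hm0, hsq⟩ := exists_mem_normSet_quadOrder_not_isSquare hd h4
  obtain ⟨h1, h2⟩ := modularPoly_ne_zero_and_isIntegral hm0 hsq
  refine ⟨modularPoly hm0, h1, h2, fun c => ?_⟩
  refine ClassGroup.induction K (fun I => ?_) c
  obtain ⟨-, ω, -, -, hω, hj⟩ := exists_upperLattice_of_unit hK φ I
  rw [hj, modularPoly_isRoot_iff, hω, hR]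
  exact hm

end

end

/-! ### Finiteness, integrality and the class polynomial -/

theorem mainTheorem4 {K : Type*} [Field K] [NumberField K] [NumberField.IsTotallyComplex K]
    (hK : Module.finrank ℚ K = 2) (φ : K →+* ℂ) (R : Subring K) [IsNumberFieldOrder R] :
    Finite (ClassGroup R) ∧
      (∀ c : ClassGroup R, IsIntegral ℤ (classInvariant φ c)) ∧
      ∃ P : ℤ[X], P.map (Int.castRingHom ℂ) = classPolynomial R φ := by
  obtain ⟨f, hf0, hfint, hfroot⟩ := exists_isRoot_classInvariant hK φ R
  have hinj := classInvariant_injective (R := R) hK φ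
  have hfin : Finite (ClassGroup R) :=
    Finite.of_injective (β := {x : ℂ // x ∈ f.roots.toFinset})
      (fun c => ⟨classInvariant φ c, by
        rw [Multiset.mem_toFinset, Polynomial.mem_roots hf0]; exact hfroot c⟩)
      fun c c' h => hinj (congrArg Subtype.val h)
  have hint : ∀ c : ClassGroup R, IsIntegral ℤ (classInvariant φ c) := fun c => hfint _ (hfroot c)
  refine ⟨hfin, hint, ?_⟩
  have := Fintype.ofFinite (ClassGroup R)
  have hfixed : ∀ σ : ℂ →+* ℂ, (classPolynomial R φ).map σ = classPolynomial R φ := by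
    intro σ
    choose e he using exists_classInvariant_eq_map (R := R) hK φ σ
    -- Both σ and the class invariant are injective, so the induced map on the finite class group is
    -- a permutation.
    have hbij : Function.Bijective e := Finite.injective_iff_bijective.1 fun c c' h =>
      hinj (σ.injective (by rw [← he, h, he]))
    rw [classPolynomial, finprod_eq_prod_of_fintype, Polynomial.map_prod]
    refine Fintype.prod_bijective e hbij _ _ fun c => ?_
    rw [Polynomial.map_sub, Polynomial.map_X, Polynomial.map_C, he]
  have hcoeff : ∀ n, IsIntegral ℤ ((classPolynomial R φ).coeff n) := by
    have : classPolynomial R φ ∈ Polynomial.lifts (algebraMap (integralClosure ℤ ℂ) ℂ) := by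
      rw [classPolynomial, finprod_eq_prod_of_fintype]
      refine Subsemiring.prod_mem _ fun c _ => ?_
      rw [Polynomial.mem_lifts]
      exact ⟨Polynomial.X - Polynomial.C ⟨classInvariant φ c, hint c⟩, by
        rw [Polynomial.map_sub, Polynomial.map_X, Polynomial.map_C]; rfl⟩
    intro n
    obtain ⟨y, hy⟩ := (Polynomial.lifts_iff_coeff_lifts _).1 this n
    rw [← hy]
    exact y.2
  have hlift : classPolynomial R φ ∈ Polynomial.lifts (Int.castRingHom ℂ) := by
    rw [Polynomial.lifts_iff_coeff_lifts]
    intro n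
    obtain ⟨k, hk⟩ := exists_int_of_isIntegral_of_fixed (hcoeff n) fun σ => by
      rw [← Polynomial.coeff_map, hfixed σ]
    exact ⟨k, hk⟩
  exact (Polynomial.mem_lifts _).1 hlift
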